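/- A \emph{deviation} on a distributive lattice $D$ with least element $0$ is a binary operation $\smallsetminus$ on $D$ such that $x\le y\vee(x\smallsetminus y)$ and $(x\smallsetminus y)\wedge(y\smallsetminus x)=0$ for all $x,y\in D$. It is \emph{monotone} if $x\smallsetminus y$ is isotone in $x$ and antitone in $y$, and \emph{Cevian} if $x\smallsetminus z\le(x\smallsetminus y)\vee(y\smallsetminus z)$ for all $x,y,z\in D$. The lattice $D$ is \emph{monotone-Cevian} if it has a deviation that is both monotone and Cevian. For an Abelian $\ell$-group (lattice-ordered Abelian group) $G$ with positive cone $G^+=\{a\in G\mid a\ge 0\}$ and $a\in G$, let $\langle a\rangle=\{x\in G\mid -n|a|\le x\le n|a|\text{ for some }n\in\mathbb{N}\}$ be the $\ell$-ideal generated by $a$, where $|a|=a\vee(-a)$ and $0\in\mathbb{N}$. Ordered by inclusion, the principal $\ell$-ideals $\langle a\rangle$, $a\in G$, form a distributive lattice $\mathrm{Id}_{\mathrm c}\,G$ with least element $\{0\}$. The \emph{Belluce map} of $G$ is the map $\beta\colon G^+\to\mathrm{Id}_{\mathrm c}\,G$, $a\mapsto\langle a\rangle$. \textbf{Corollary.}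 Let $I$ be any set and let $G$ be the free Abelian $\ell$-group on $I$. Then the lattice $\mathrm{Id}_{\mathrm c}\,G$ is monotone-Cevian. Moreover, the Belluce map of $G$ has an isotone section, that is, there is an order-preserving map $\sigma\colon\mathrm{Id}_{\mathrm c}\,G\to G^+$ such that $\langle\sigma(J)\rangle=J$ for every $J\in\mathrm{Id}_{\mathrm c}\,G$. -/

import Mathlib

/-! Deviations on distributive lattices with zero -/

/-- A deviation on a distributive lattice with zero `D` is a binary operation `d` with
`x ≤ y ⊔ d x y` and `d x y ⊓ d y x = ⊥` for all `x y`. -/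
structure IsDeviation {D : Type*} [DistribLattice D] [OrderBot D] (d : D → D → D) : Prop where
  le_sup : ∀ x y, x ≤ y ⊔ d x y
  inf_eq_bot : ∀ x y, d x y ⊓ d y x = ⊥

/-- A monotone-Cevian deviation: isotone in the left variable, antitone in the right variable,
and satisfying `d x z ≤ d x y ⊔ d y z`. -/
structure IsMonotoneCevianDeviation {D : Type*} [DistribLattice D] [OrderBot D]
    (d : D → D → D) : Prop extends IsDeviation d where
  left_isotone : ∀ x x' y, x ≤ x' → d x y ≤ d x' y
  right_antitone : ∀ x y y', y ≤ y' → d x y' ≤ d x y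
  cevian : ∀ x y z, d x z ≤ d x y ⊔ d y z

/-- A distributive lattice with zero is monotone-Cevian if it has a monotone-Cevian deviation. -/
def IsMonotoneCevian (D : Type*) [DistribLattice D] [OrderBot D] : Prop :=
  ∃ d : D → D → D, IsMonotoneCevianDeviation d

/-! Principal ℓ-ideals of an Abelian ℓ-group (a lattice-ordered commutative group) -/

section PrincipalIdeals

variable {G : Type*} [AddCommGroup G] [Lattice G] [IsOrderedAddMonoid G]

/-- An ℓ-ideal of an Abelian ℓ-group is a subgroup `J` such that `|x| ≤ |y|` and `y ∈ J` imply
`x ∈ J` (equivalently, a convex ℓ-subgroup). -/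
def IsLIdeal (J : AddSubgroup G) : Prop :=
  ∀ x y : G, |x| ≤ |y| → y ∈ J → x ∈ J

/-- The ℓ-ideal generated by `a`: all `x` such that `-n|a| ≤ x ≤ n|a|` for some natural `n`. -/
def lIdealSpan (a : G) : AddSubgroup G where
  carrier := {x | ∃ n : ℕ, -(n • |a|) ≤ x ∧ x ≤ n • |a|}
  zero_mem' := ⟨0, by simp⟩
  add_mem' := by
    rintro x y ⟨n, hn, hn'⟩ ⟨m, hm, hm'⟩
    refine ⟨n + m, ?_, ?_⟩
    · rw [add_nsmul, neg_add]
      exact add_le_add hn hm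
    · rw [add_nsmul]
      exact add_le_add hn' hm'
  neg_mem' := by
    rintro x ⟨n, hn, hn'⟩
    exact ⟨n, neg_le_neg hn', neg_le.mp hn⟩

theorem mem_lIdealSpan {a x : G} : x ∈ lIdealSpan a ↔ ∃ n : ℕ, |x| ≤ n • |a| := by
  constructor
  · rintro ⟨n, h1, h2⟩
    exact ⟨n, abs_le'.mpr ⟨h2, neg_le.mp h1⟩⟩
  · rintro ⟨n, h⟩
    exact ⟨n, neg_le.mp (abs_le'.mp h).2, (abs_le'.mp h).1⟩

theorem self_mem_lIdealSpan (a : G) : a ∈ lIdealSpan a :=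
  mem_lIdealSpan.mpr ⟨1, by simp⟩

theorem isLIdeal_lIdealSpan (a : G) : IsLIdeal (lIdealSpan a) := by
  intro x y hxy hy
  obtain ⟨n, hn⟩ := mem_lIdealSpan.mp hy
  exact mem_lIdealSpan.mpr ⟨n, hxy.trans hn⟩

/-- `lIdealSpan a` is the least ℓ-ideal containing `a`. -/
theorem lIdealSpan_le {a : G} {J : AddSubgroup G} (hJ : IsLIdeal J) :
    lIdealSpan a ≤ J ↔ a ∈ J := by
  constructor
  · intro h
    exact h (self_mem_lIdealSpan a)
  · intro h x hx
    obtain ⟨n, hn⟩ := mem_lIdealSpan.mp hx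
    have h1 : |a| ∈ J := hJ _ a (by rw [abs_abs]) h
    refine hJ x (n • |a|) ?_ (J.nsmul_mem h1 n)
    rwa [abs_of_nonneg (nsmul_nonneg (abs_nonneg a) n)]

theorem inf_add_le_add_inf {x a b : G} (hx : 0 ≤ x) (ha : 0 ≤ a) (hb : 0 ≤ b) :
    x ⊓ (a + b) ≤ x ⊓ a + x ⊓ b := by
  rw [add_inf, inf_add, inf_add]
  refine le_inf (le_inf ?_ ?_) (le_inf ?_ ?_)
  · exact inf_le_left.trans (le_add_of_nonneg_right hx)
  · exact inf_le_left.trans (le_add_of_nonneg_left ha)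
  · exact inf_le_left.trans (le_add_of_nonneg_right hb)
  · exact inf_le_right

theorem inf_nsmul_le_nsmul_inf {x a : G} (hx : 0 ≤ x) (ha : 0 ≤ a) (n : ℕ) :
    x ⊓ n • a ≤ n • (x ⊓ a) := by
  induction n with
  | zero => simp
  | succ n ih =>
    rw [succ_nsmul, succ_nsmul]
    exact (inf_add_le_add_inf hx (nsmul_nonneg ha n) ha).trans (by gcongr)

theorem lIdealSpan_inf (a b : G) :
    lIdealSpan a ⊓ lIdealSpan b = lIdealSpan (|a| ⊓ |b|) := by
  have h0 : 0 ≤ |a| ⊓ |b| := le_inf (abs_nonneg a) (abs_nonneg b)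
  apply le_antisymm
  · rintro x ⟨hx, hx'⟩
    obtain ⟨n, hn⟩ := mem_lIdealSpan.mp hx
    obtain ⟨m, hm⟩ := mem_lIdealSpan.mp hx'
    refine mem_lIdealSpan.mpr ⟨n * m, ?_⟩
    rw [abs_of_nonneg h0, mul_nsmul]
    have hnb : 0 ≤ n • |a| := nsmul_nonneg (abs_nonneg a) n
    calc |x| ≤ n • |a| ⊓ m • |b| := le_inf hn hm
      _ ≤ m • (n • |a| ⊓ |b|) := inf_nsmul_le_nsmul_inf hnb (abs_nonneg b) m
      _ ≤ m • (n • (|a| ⊓ |b|)) := by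
          refine nsmul_le_nsmul_right ?_ m
          rw [inf_comm, inf_comm |a|]
          exact inf_nsmul_le_nsmul_inf (abs_nonneg b) (abs_nonneg a) n
  · refine (lIdealSpan_le fun x y hxy hy => ?_).mpr ⟨?_, ?_⟩
    · exact ⟨isLIdeal_lIdealSpan a x y hxy hy.1, isLIdeal_lIdealSpan b x y hxy hy.2⟩
    · exact mem_lIdealSpan.mpr ⟨1, by rw [abs_of_nonneg h0, one_nsmul]; exact inf_le_left⟩
    · exact mem_lIdealSpan.mpr ⟨1, by rw [abs_of_nonneg h0, one_nsmul]; exact inf_le_right⟩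

theorem lIdealSpan_sup (a b : G) :
    lIdealSpan a ⊔ lIdealSpan b = lIdealSpan (|a| ⊔ |b|) := by
  have h0 : 0 ≤ |a| ⊔ |b| := (abs_nonneg a).trans le_sup_left
  apply le_antisymm
  · refine sup_le ?_ ?_
    · refine (lIdealSpan_le (isLIdeal_lIdealSpan _)).mpr (mem_lIdealSpan.mpr ⟨1, ?_⟩)
      rw [abs_of_nonneg h0, one_nsmul]
      exact le_sup_left
    · refine (lIdealSpan_le (isLIdeal_lIdealSpan _)).mpr (mem_lIdealSpan.mpr ⟨1, ?_⟩)
      rw [abs_of_nonneg h0, one_nsmul]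
      exact le_sup_right
  · have key : ∀ x : G, 0 ≤ x → x ∈ lIdealSpan (|a| ⊔ |b|) →
        x ∈ lIdealSpan a ⊔ lIdealSpan b := by
      intro x hx hm
      obtain ⟨n, hn⟩ := mem_lIdealSpan.mp hm
      rw [abs_of_nonneg h0, abs_of_nonneg hx] at hn
      have ha : 0 ≤ n • |a| := nsmul_nonneg (abs_nonneg a) n
      have hb : 0 ≤ n • |b| := nsmul_nonneg (abs_nonneg b) n
      have hle : x ≤ n • |a| + n • |b| := by
        rw [← nsmul_add]
        refine hn.trans (nsmul_le_nsmul_right (sup_le ?_ ?_) n)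
        · exact le_add_of_nonneg_right (abs_nonneg b)
        · exact le_add_of_nonneg_left (abs_nonneg a)
      have h1 : x ⊓ n • |a| ∈ lIdealSpan a :=
        mem_lIdealSpan.mpr ⟨n, by rw [abs_of_nonneg (le_inf hx ha)]; exact inf_le_right⟩
      have h2 : x - x ⊓ n • |a| ∈ lIdealSpan b := by
        refine mem_lIdealSpan.mpr ⟨n, ?_⟩
        rw [abs_of_nonneg (sub_nonneg.mpr inf_le_left), sub_le_iff_le_add', inf_add]
        exact le_inf (le_add_of_nonneg_right hb) hle
      have h3 := AddSubgroup.add_mem_sup h1 h2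
      rwa [add_sub_cancel] at h3
    intro x hx
    rw [← posPart_sub_negPart x]
    refine AddSubgroup.sub_mem _ (key _ (posPart_nonneg x) ?_) (key _ (negPart_nonneg x) ?_)
    · refine isLIdeal_lIdealSpan _ _ x ?_ hx
      rw [abs_of_nonneg (posPart_nonneg x), posPart_def]
      exact sup_le (le_abs_self x) (abs_nonneg x)
    · refine isLIdeal_lIdealSpan _ _ x ?_ hx
      rw [abs_of_nonneg (negPart_nonneg x), negPart_def]
      exact sup_le (neg_le_abs x) (abs_nonneg x)

variable (G) in
/-- The set of all principal ℓ-ideals of an Abelian ℓ-group. -/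
def PrincipalLIdeal : Type _ := {J : AddSubgroup G // ∃ a : G, J = lIdealSpan a}

/-- Principal ℓ-ideals, ordered by inclusion, form a distributive lattice: the meet is the
intersection and the join is the subgroup sum. -/
instance PrincipalLIdeal.instDistribLattice : DistribLattice (PrincipalLIdeal G) where
  le J K := J.1 ≤ K.1
  le_refl J := le_refl J.1
  le_trans _ _ _ h h' := le_trans (α := AddSubgroup G) h h'
  le_antisymm _ _ h h' := Subtype.ext (le_antisymm h h')
  sup J K := ⟨J.1 ⊔ K.1, by
    obtain ⟨J, a, rfl⟩ := J
    obtain ⟨K, b, rfl⟩ := K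
    exact ⟨_, lIdealSpan_sup a b⟩⟩
  inf J K := ⟨J.1 ⊓ K.1, by
    obtain ⟨J, a, rfl⟩ := J
    obtain ⟨K, b, rfl⟩ := K
    exact ⟨_, lIdealSpan_inf a b⟩⟩
  le_sup_left J K := le_sup_left (α := AddSubgroup G)
  le_sup_right J K := le_sup_right (α := AddSubgroup G)
  sup_le _ _ _ h h' := sup_le (α := AddSubgroup G) h h'
  inf_le_left J K := inf_le_left (α := AddSubgroup G)
  inf_le_right J K := inf_le_right (α := AddSubgroup G)
  le_inf _ _ _ h h' := le_inf (α := AddSubgroup G) h h'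
  le_sup_inf := by
    rintro ⟨J, a, rfl⟩ ⟨K, b, rfl⟩ ⟨L, c, rfl⟩
    change (lIdealSpan a ⊔ lIdealSpan b) ⊓ (lIdealSpan a ⊔ lIdealSpan c) ≤
      lIdealSpan a ⊔ lIdealSpan b ⊓ lIdealSpan c
    have ha := abs_nonneg a
    have hb := abs_nonneg b
    have hc := abs_nonneg c
    let _ : DistribLattice G := AddCommGroup.toDistribLattice G
    rw [lIdealSpan_sup, lIdealSpan_sup, lIdealSpan_inf, lIdealSpan_inf, lIdealSpan_sup,
      abs_of_nonneg (ha.trans le_sup_left), abs_of_nonneg (ha.trans le_sup_left),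
      abs_of_nonneg (le_inf hb hc), sup_inf_left]

/-- The least principal ℓ-ideal is the zero ideal. -/
instance PrincipalLIdeal.instOrderBot : OrderBot (PrincipalLIdeal G) where
  bot := ⟨⊥, 0, by
    apply le_antisymm bot_le
    intro x hx
    obtain ⟨n, h1, h2⟩ := hx
    simp only [abs_zero, nsmul_zero, neg_zero] at h1 h2
    exact (AddSubgroup.mem_bot).mpr (le_antisymm h2 h1)⟩
  bot_le J := bot_le (α := AddSubgroup G) (a := J.1)

/-- The Belluce map of an Abelian ℓ-group: it sends an element of the positive cone to the
principal ℓ-ideal that it generates. -/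
def belluceMap (a : {a : G // 0 ≤ a}) : PrincipalLIdeal G :=
  ⟨lIdealSpan a.1, a.1, rfl⟩

end PrincipalIdeals

/-! The free Abelian ℓ-group on a set: terms in the language `(0, +, -, ⊔, ⊓)` with variables
in `I`, modulo the congruence generated by the identities of Abelian ℓ-groups -/

/-- Terms of the language of ℓ-groups with variables in `I`. -/
inductive LGroupTerm (I : Type*) where
  | of (i : I) : LGroupTerm I
  | zero : LGroupTerm I
  | add (s t : LGroupTerm I) : LGroupTerm I
  | neg (t : LGroupTerm I) : LGroupTerm I
  | sup (s t : LGroupTerm I) : LGroupTerm I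
  | inf (s t : LGroupTerm I) : LGroupTerm I

/-- The least congruence on terms that contains all the identities of Abelian ℓ-groups: those of
commutative groups, those of lattices, and the distributivity of addition over joins. -/
inductive LGroupTerm.Rel {I : Type*} : LGroupTerm I → LGroupTerm I → Prop
  | refl (s : LGroupTerm I) : Rel s s
  | symm {s t : LGroupTerm I} : Rel s t → Rel t s
  | trans {s t u : LGroupTerm I} : Rel s t → Rel t u → Rel s u
  | add_congr {s s' t t' : LGroupTerm I} : Rel s s' → Rel t t' → Rel (s.add t) (s'.add t')
  | neg_congr {s s' : LGroupTerm I} : Rel s s' → Rel s.neg s'.neg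
  | sup_congr {s s' t t' : LGroupTerm I} : Rel s s' → Rel t t' → Rel (s.sup t) (s'.sup t')
  | inf_congr {s s' t t' : LGroupTerm I} : Rel s s' → Rel t t' → Rel (s.inf t) (s'.inf t')
  | add_assoc (s t u : LGroupTerm I) : Rel ((s.add t).add u) (s.add (t.add u))
  | add_comm (s t : LGroupTerm I) : Rel (s.add t) (t.add s)
  | zero_add (s : LGroupTerm I) : Rel (zero.add s) s
  | neg_add_cancel (s : LGroupTerm I) : Rel (s.neg.add s) zero
  | sup_comm (s t : LGroupTerm I) : Rel (s.sup t) (t.sup s)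
  | sup_assoc (s t u : LGroupTerm I) : Rel ((s.sup t).sup u) (s.sup (t.sup u))
  | inf_comm (s t : LGroupTerm I) : Rel (s.inf t) (t.inf s)
  | inf_assoc (s t u : LGroupTerm I) : Rel ((s.inf t).inf u) (s.inf (t.inf u))
  | sup_inf_self (s t : LGroupTerm I) : Rel (s.sup (s.inf t)) s
  | inf_sup_self (s t : LGroupTerm I) : Rel (s.inf (s.sup t)) s
  | add_sup (s t u : LGroupTerm I) : Rel (s.add (t.sup u)) ((s.add t).sup (s.add u))

/-- The congruence on terms as a setoid. -/
def LGroupTerm.setoid (I : Type*) : Setoid (LGroupTerm I) where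
  r := LGroupTerm.Rel
  iseqv := ⟨LGroupTerm.Rel.refl, LGroupTerm.Rel.symm, LGroupTerm.Rel.trans⟩

/-- The free Abelian ℓ-group on `I`. -/
def FreeAbelianLGroup (I : Type*) : Type _ := Quotient (LGroupTerm.setoid I)

namespace FreeAbelianLGroup

/-- The canonical generators of the free Abelian ℓ-group. -/
def of {I : Type*} (i : I) : FreeAbelianLGroup I :=
  Quotient.mk (LGroupTerm.setoid I) (LGroupTerm.of i)

instance instAdd (I : Type*) : Add (FreeAbelianLGroup I) where
  add := Quotient.map₂ LGroupTerm.add fun _ _ h _ _ h' => LGroupTerm.Rel.add_congr h h'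

instance instZero (I : Type*) : Zero (FreeAbelianLGroup I) where
  zero := Quotient.mk (LGroupTerm.setoid I) LGroupTerm.zero

instance instNeg (I : Type*) : Neg (FreeAbelianLGroup I) where
  neg := Quotient.map LGroupTerm.neg fun _ _ h => LGroupTerm.Rel.neg_congr h

instance instAddCommGroup (I : Type*) : AddCommGroup (FreeAbelianLGroup I) where
  add_assoc := by
    rintro ⟨s⟩ ⟨t⟩ ⟨u⟩
    exact Quotient.sound (LGroupTerm.Rel.add_assoc s t u)
  zero_add := by
    rintro ⟨s⟩
    exact Quotient.sound (LGroupTerm.Rel.zero_add s)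
  add_zero := by
    rintro ⟨s⟩
    exact Quotient.sound ((LGroupTerm.Rel.add_comm s _).trans (LGroupTerm.Rel.zero_add s))
  add_comm := by
    rintro ⟨s⟩ ⟨t⟩
    exact Quotient.sound (LGroupTerm.Rel.add_comm s t)
  neg_add_cancel := by
    rintro ⟨s⟩
    exact Quotient.sound (LGroupTerm.Rel.neg_add_cancel s)
  nsmul := nsmulRec
  zsmul := zsmulRec

/-- The lattice structure; the order is `x ≤ y ↔ x ⊔ y = y`. -/
instance instLattice (I : Type*) : Lattice (FreeAbelianLGroup I) :=
  @Lattice.mk' (FreeAbelianLGroup I)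
    ⟨Quotient.map₂ LGroupTerm.sup fun _ _ h _ _ h' => LGroupTerm.Rel.sup_congr h h'⟩
    ⟨Quotient.map₂ LGroupTerm.inf fun _ _ h _ _ h' => LGroupTerm.Rel.inf_congr h h'⟩
    (by rintro ⟨s⟩ ⟨t⟩; exact Quotient.sound (LGroupTerm.Rel.sup_comm s t))
    (by rintro ⟨s⟩ ⟨t⟩ ⟨u⟩; exact Quotient.sound (LGroupTerm.Rel.sup_assoc s t u))
    (by rintro ⟨s⟩ ⟨t⟩; exact Quotient.sound (LGroupTerm.Rel.inf_comm s t))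
    (by rintro ⟨s⟩ ⟨t⟩ ⟨u⟩; exact Quotient.sound (LGroupTerm.Rel.inf_assoc s t u))
    (by rintro ⟨s⟩ ⟨t⟩; exact Quotient.sound (LGroupTerm.Rel.sup_inf_self s t))
    (by rintro ⟨s⟩ ⟨t⟩; exact Quotient.sound (LGroupTerm.Rel.inf_sup_self s t))

theorem add_sup_eq {I : Type*} (x y z : FreeAbelianLGroup I) :
    x + (y ⊔ z) = (x + y) ⊔ (x + z) := by
  obtain ⟨s⟩ := x
  obtain ⟨t⟩ := y
  obtain ⟨u⟩ := z
  exact Quotient.sound (LGroupTerm.Rel.add_sup s t u)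

instance instIsOrderedAddMonoid (I : Type*) : IsOrderedAddMonoid (FreeAbelianLGroup I) where
  add_le_add_left x y h z := by
    rw [add_comm x z, add_comm y z, ← sup_eq_right, ← add_sup_eq, sup_eq_right.mpr h]

end FreeAbelianLGroup

section UniversalProperty

variable {I : Type*} {H : Type*} [AddCommGroup H] [Lattice H]

/-- The value of a term under an assignment of its variables. -/
def LGroupTerm.eval (f : I → H) : LGroupTerm I → H
  | .of i => f i
  | .zero => 0
  | .add s t => s.eval f + t.eval f
  | .neg t => -t.eval f
  | .sup s t => s.eval f ⊔ t.eval f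
  | .inf s t => s.eval f ⊓ t.eval f

variable [IsOrderedAddMonoid H]

theorem LGroupTerm.Rel.eval_eq (f : I → H) {s t : LGroupTerm I} (h : s.Rel t) :
    s.eval f = t.eval f := by
  induction h with
  | refl => rfl
  | symm _ ih => exact ih.symm
  | trans _ _ ih ih' => exact ih.trans ih'
  | add_congr _ _ ih ih' => simp only [LGroupTerm.eval, ih, ih']
  | neg_congr _ ih => simp only [LGroupTerm.eval, ih]
  | sup_congr _ _ ih ih' => simp only [LGroupTerm.eval, ih, ih']
  | inf_congr _ _ ih ih' => simp only [LGroupTerm.eval, ih, ih']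
  | add_assoc => exact _root_.add_assoc _ _ _
  | add_comm => exact _root_.add_comm _ _
  | zero_add => exact _root_.zero_add _
  | neg_add_cancel => exact _root_.neg_add_cancel _
  | sup_comm => exact _root_.sup_comm _ _
  | sup_assoc => exact _root_.sup_assoc _ _ _
  | inf_comm => exact _root_.inf_comm _ _
  | inf_assoc => exact _root_.inf_assoc _ _ _
  | sup_inf_self => exact _root_.sup_inf_self
  | inf_sup_self => exact _root_.inf_sup_self
  | add_sup => exact _root_.add_sup _ _ _

/-- The universal property: every map from `I` to an Abelian ℓ-group extends uniquely to a
homomorphism of ℓ-groups on the free Abelian ℓ-group. -/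
theorem FreeAbelianLGroup.existsUnique_lift (f : I → H) :
    ∃! φ : FreeAbelianLGroup I →+ H,
      (∀ x y, φ (x ⊔ y) = φ x ⊔ φ y) ∧ (∀ x y, φ (x ⊓ y) = φ x ⊓ φ y) ∧
        ∀ i, φ (FreeAbelianLGroup.of i) = f i := by
  refine ⟨{ toFun := Quotient.lift (LGroupTerm.eval f) fun _ _ h => LGroupTerm.Rel.eval_eq f h,
            map_zero' := rfl, map_add' := ?_ }, ⟨?_, ?_, fun _ => rfl⟩, ?_⟩
  · rintro ⟨s⟩ ⟨t⟩
    rfl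
  · rintro ⟨s⟩ ⟨t⟩
    rfl
  · rintro ⟨s⟩ ⟨t⟩
    rfl
  · rintro ψ ⟨hsup, hinf, hof⟩
    ext x
    obtain ⟨t⟩ := x
    change ψ (Quotient.mk (LGroupTerm.setoid I) t) = t.eval f
    induction t with
    | of i => exact hof i
    | zero => exact map_zero ψ
    | add s t ihs iht => exact (map_add ψ _ _).trans (congrArg₂ _ ihs iht)
    | neg t ih => exact (map_neg ψ _).trans (congrArg _ ih)
    | sup s t ihs iht => exact (hsup _ _).trans (congrArg₂ _ ihs iht)
    | inf s t ihs iht => exact (hinf _ _).trans (congrArg₂ _ ihs iht)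

end UniversalProperty

/-! An isotone section `σ` of the Belluce map suffices: sending `J`, `K` to the ℓ-ideal generated by
`(σ J - σ K)⁺` is then a monotone Cevian deviation (`isMonotoneCevian_of_section`). On the positive
cone the Belluce map is a surjective lattice homomorphism, so `σ` can be built by transfinite
recursion. The value at `J` must lie above finitely many earlier values and below finitely many
others, which joins and meets achieve, as soon as every comparability between `J` and an earlier
element passes through a finite set of earlier elements (`exists_monotone_section`).

Such a well-ordering exists because variables can be eliminated (`exists_wellOrder_interpolation`).
Give each ideal a finite support of least cardinality, and sort by that cardinality, then by the
support, then by an enumeration of the countably many ideals with that support. If `K` precedes `J`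
and has another support, some variable of `J` is absent from `K`. The largest ideal below `J`, or
the least one above it, that avoids these absent variables then lies between `K` and `J` and has
fewer variables than `J`, hence is earlier.

These floors and ceilings come from minimizing or maximizing a positive term `t` over one variable.
Inequalities between terms may be tested in totally ordered groups (`toFree_le_of_linearOrder`),
where `t` is piecewise linear in that variable. If it is bounded below, its minimum is attained at
one of finitely many candidates: zero and the points where two linear forms cross. Multiplying the
other variables by a suitable `N` clears denominators, so the minimum is itself a term
(`exists_min_term`); rescaling does not matter for generated ideals. -/

/-! ### Totally ordered quotients of an Abelian ℓ-group -/

section Representation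

variable {G : Type*} [AddCommGroup G] [Lattice G] [IsOrderedAddMonoid G]

/-- The ℓ-ideal generated by an ℓ-ideal `J` and a positive element `a`. -/
def lIdealAdjoin (J : AddSubgroup G) (a : G) : AddSubgroup G where
  carrier := {x | ∃ j ∈ J, ∃ n : ℕ, -(j + n • a) ≤ x ∧ x ≤ j + n • a}
  zero_mem' := ⟨0, J.zero_mem, 0, by simp⟩
  add_mem' := by
    rintro x y ⟨j, hj, n, h1, h2⟩ ⟨k, hk, m, h3, h4⟩
    have e : j + k + (n + m) • a = (j + n • a) + (k + m • a) := by rw [add_nsmul]; abel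
    refine ⟨j + k, J.add_mem hj hk, n + m, ?_, ?_⟩
    · rw [e, neg_add]
      exact add_le_add h1 h3
    · rw [e]
      exact add_le_add h2 h4
  neg_mem' := by
    rintro x ⟨j, hj, n, h1, h2⟩
    exact ⟨j, hj, n, neg_le_neg h2, neg_le.mp h1⟩

theorem isLIdeal_lIdealAdjoin (J : AddSubgroup G) (a : G) : IsLIdeal (lIdealAdjoin J a) := by
  rintro x y hxy ⟨j, hj, n, h1, h2⟩
  have h : |x| ≤ j + n • a := hxy.trans (abs_le'.mpr ⟨h2, neg_le.mp h1⟩)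
  exact ⟨j, hj, n, neg_le.mp (abs_le'.mp h).2, (abs_le'.mp h).1⟩

theorem le_lIdealAdjoin {J : AddSubgroup G} (hJ : IsLIdeal J) (a : G) :
    J ≤ lIdealAdjoin J a := by
  intro x hx
  refine ⟨|x|, hJ _ x (by rw [abs_abs]) hx, 0, ?_⟩
  simp only [zero_nsmul, add_zero]
  exact ⟨neg_le.mp (neg_le_abs x), le_abs_self x⟩

theorem mem_lIdealAdjoin {J : AddSubgroup G} {a : G} (ha : 0 ≤ a) : a ∈ lIdealAdjoin J a := by
  refine ⟨0, J.zero_mem, 1, ?_⟩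
  simp only [one_nsmul, zero_add]
  exact ⟨(neg_nonpos.mpr ha).trans ha, le_rfl⟩

/-- An ℓ-ideal that is maximal among those avoiding a given element contains one of any two
disjoint positive elements. -/
theorem mem_or_mem_of_maximal {J : AddSubgroup G} {x : G} (hx : 0 ≤ x)
    (hJ : Maximal (· ∈ {J : AddSubgroup G | IsLIdeal J ∧ x ∉ J}) J) {a b : G} (ha : 0 ≤ a)
    (hb : 0 ≤ b) (hab : a ⊓ b = 0) : a ∈ J ∨ b ∈ J := by
  -- By maximality, adjoining any positive `c` outside `J` already captures `x`.
  have key : ∀ c : G, 0 ≤ c → c ∉ J → ∃ j ∈ J, ∃ n : ℕ, 0 ≤ j ∧ x ≤ j + n • c := by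
    intro c hc hcJ
    by_contra! H
    refine hcJ (hJ.2 (y := lIdealAdjoin J c) ⟨isLIdeal_lIdealAdjoin J c, ?_⟩
      (le_lIdealAdjoin hJ.1.1 c) (mem_lIdealAdjoin hc))
    rintro ⟨j, hj, n, -, h⟩
    exact H |j| (hJ.1.1 _ j (by rw [abs_abs]) hj) n (abs_nonneg j)
      (h.trans (by gcongr; exact le_abs_self j))
  by_contra! H
  obtain ⟨j, hj, n, hj0, h1⟩ := key a ha H.1
  obtain ⟨k, hk, m, hk0, h2⟩ := key b hb H.2
  have hna := nsmul_nonneg ha n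
  have hmb := nsmul_nonneg hb m
  have h3 : n • a ⊓ m • b ≤ 0 := by
    calc n • a ⊓ m • b ≤ m • (n • a ⊓ b) := inf_nsmul_le_nsmul_inf hna hb m
      _ ≤ m • (n • (a ⊓ b)) := by
          refine nsmul_le_nsmul_right ?_ m
          rw [inf_comm, inf_comm a]
          exact inf_nsmul_le_nsmul_inf hb ha n
      _ = 0 := by rw [hab, nsmul_zero, nsmul_zero]
  -- Meeting the two bounds on `x` leaves only `j + k`, as multiples of `a` and `b` are still
  -- disjoint; convexity then puts `x` in `J`.
  have h4 : x ≤ j + k := by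
    calc x ≤ (j + k + n • a) ⊓ (j + k + m • b) := by
          refine le_inf (h1.trans ?_) (h2.trans ?_)
          · gcongr
            exact le_add_of_nonneg_right hk0
          · gcongr
            exact le_add_of_nonneg_left hj0
      _ = j + k + n • a ⊓ m • b := (add_inf _ _ _).symm
      _ ≤ j + k := by simpa using h3
  refine hJ.1.2 (hJ.1.1 x (j + k) ?_ (J.add_mem hj hk))
  rwa [abs_of_nonneg hx, abs_of_nonneg (add_nonneg hj0 hk0)]

/-- Every element of an Abelian ℓ-group that is not negative becomes strictly positive in some
totally ordered quotient. -/
theorem exists_linearOrder_hom {G : Type u} [AddCommGroup G] [Lattice G] [IsOrderedAddMonoid G]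
    {x : G} (hx : ¬ x ≤ 0) :
    ∃ (H : Type u) (_ : AddCommGroup H) (_ : LinearOrder H) (_ : IsOrderedAddMonoid H)
      (φ : G →+ H), (∀ a b, φ (a ⊔ b) = φ a ⊔ φ b) ∧ (∀ a b, φ (a ⊓ b) = φ a ⊓ φ b) ∧
        0 < φ x := by
  classical
  have hx0 : x⁺ ≠ 0 := fun h => hx (posPart_eq_zero.mp h)
  obtain ⟨J, hJ⟩ : ∃ J, Maximal (· ∈ {J : AddSubgroup G | IsLIdeal J ∧ x⁺ ∉ J}) J := by
    refine (zorn_le_nonempty₀ {J : AddSubgroup G | IsLIdeal J ∧ x⁺ ∉ J} ?_ ⊥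
      ⟨?_, fun h => hx0 ((AddSubgroup.mem_bot).mp h)⟩).imp fun _ h => h.2
    · intro C hC hchain K hK
      have hdir : DirectedOn (· ≤ ·) C := hchain.directedOn
      have hmem : ∀ y, y ∈ sSup C ↔ ∃ L ∈ C, y ∈ L := fun y =>
        AddSubgroup.mem_sSup_of_directedOn ⟨K, hK⟩ hdir
      refine ⟨sSup C, ⟨?_, ?_⟩, fun L hL => le_sSup hL⟩
      · intro y z hyz hz
        obtain ⟨L, hL, hzL⟩ := (hmem z).mp hz
        exact (hmem y).mpr ⟨L, hL, (hC hL).1 y z hyz hzL⟩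
      · intro h
        obtain ⟨L, hL, hxL⟩ := (hmem _).mp h
        exact (hC hL).2 hxL
    · intro y z hyz hz
      rw [AddSubgroup.mem_bot] at hz ⊢
      rw [hz, abs_zero] at hyz
      have h := abs_le'.mp hyz
      exact le_antisymm h.1 (neg_nonpos.mp h.2)
  have hprime : ∀ a : G, a⁺ ∈ J ∨ a⁻ ∈ J := fun a =>
    mem_or_mem_of_maximal (posPart_nonneg x) hJ (posPart_nonneg a) (negPart_nonneg a)
      (posPart_inf_negPart_eq_zero a)
  let π : G →+ G ⧸ J := QuotientAddGroup.mk' J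
  have hπ : ∀ a, π a = 0 ↔ a ∈ J := fun a => QuotientAddGroup.eq_zero_iff a
  -- The image of the positive cone is pointed because `J` is convex, and total because `J` contains
  -- `a⁺` or `a⁻` for each `a`.
  let C : AddGroupCone (G ⧸ J) :=
    { carrier := {q | ∃ a, 0 ≤ a ∧ π a = q}
      zero_mem' := ⟨0, le_rfl, map_zero π⟩
      add_mem' := by
        rintro _ _ ⟨a, ha, rfl⟩ ⟨b, hb, rfl⟩
        exact ⟨a + b, add_nonneg ha hb, map_add π a b⟩
      eq_zero_of_mem_of_neg_mem' := by
        rintro _ ⟨a, ha, rfl⟩ ⟨b, hb, h⟩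
        have hab : a + b ∈ J := by rw [← hπ, map_add, h, add_neg_cancel]
        refine (hπ a).mpr (hJ.1.1 a (a + b) ?_ hab)
        rw [abs_of_nonneg ha, abs_of_nonneg (add_nonneg ha hb)]
        exact le_add_of_nonneg_right hb }
  have htot : HasMemOrNegMem C := ⟨by
    intro q
    obtain ⟨a, rfl⟩ := QuotientAddGroup.mk'_surjective J q
    rcases hprime a with h | h
    · right
      refine ⟨a⁻, negPart_nonneg a, ?_⟩
      conv_rhs => rw [← posPart_sub_negPart a]
      rw [map_sub, (hπ _).mpr h, zero_sub, neg_neg]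
    · left
      refine ⟨a⁺, posPart_nonneg a, ?_⟩
      conv_rhs => rw [← posPart_sub_negPart a]
      rw [map_sub, (hπ _).mpr h, sub_zero]⟩
  let _ : LinearOrder (G ⧸ J) := LinearOrder.mkOfAddGroupCone C
  have : IsOrderedAddMonoid (G ⧸ J) := IsOrderedAddMonoid.mkOfCone C
  have hmono : ∀ a b, a ≤ b → π a ≤ π b := fun a b h =>
    show π b - π a ∈ C from ⟨b - a, sub_nonneg.mpr h, map_sub π b a⟩
  -- Modulo `J`, one of `(a - b)⁺` and `(a - b)⁻` vanishes, which decides which of `a`, `b`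
  -- represents the join.
  have hcases : ∀ a b : G, (π (a ⊔ b) = π a ∧ π (a ⊓ b) = π b) ∨
      (π (a ⊔ b) = π b ∧ π (a ⊓ b) = π a) := by
    intro a b
    have e1 : a ⊔ b = b + (a - b)⁺ := by
      rw [posPart_def, add_sup, add_sub_cancel, add_zero]
    have e2 : a ⊔ b = a + (a - b)⁻ := by
      rw [negPart_def, add_sup, neg_sub, add_sub_cancel, add_zero, sup_comm]
    have e3 : a ⊓ b = a + b - a ⊔ b := by rw [← inf_add_sup a b, add_sub_cancel_right]
    rcases hprime (a - b) with h | h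
    · right
      have h1 : π (a ⊔ b) = π b := by rw [e1, map_add, (hπ _).mpr h, add_zero]
      exact ⟨h1, by rw [e3, map_sub, h1, map_add, add_sub_cancel_right]⟩
    · left
      have h1 : π (a ⊔ b) = π a := by rw [e2, map_add, (hπ _).mpr h, add_zero]
      exact ⟨h1, by rw [e3, map_sub, h1, map_add, add_sub_cancel_left]⟩
  refine ⟨G ⧸ J, inferInstance, inferInstance, inferInstance, π, ?_, ?_, ?_⟩
  · intro a b
    refine le_antisymm ?_ (sup_le (hmono _ _ le_sup_left) (hmono _ _ le_sup_right))
    rcases hcases a b with h | h <;> rw [h.1]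
    exacts [le_sup_left, le_sup_right]
  · intro a b
    refine le_antisymm (le_inf (hmono _ _ inf_le_left) (hmono _ _ inf_le_right)) ?_
    rcases hcases a b with h | h <;> rw [h.2]
    exacts [inf_le_right, inf_le_left]
  · by_contra! h
    have h1 : π x⁺ ≤ 0 := by
      rcases hprime x with h2 | h2
      · rw [(hπ _).mpr h2]
      · rw [← posPart_sub_negPart x, map_sub, (hπ _).mpr h2, sub_zero] at h
        exact h
    have h2 : 0 ≤ π x⁺ := by simpa using hmono _ _ (posPart_nonneg x)
    exact hJ.1.2 ((hπ _).mp (le_antisymm h1 h2))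

end Representation

/-! ### Evaluation and substitution of terms -/

section HomEval

variable {I : Type*} {G H : Type*} [AddCommGroup G] [Lattice G] [AddCommGroup H] [Lattice H]

theorem LGroupTerm.map_eval (φ : G →+ H) (hsup : ∀ a b, φ (a ⊔ b) = φ a ⊔ φ b)
    (hinf : ∀ a b, φ (a ⊓ b) = φ a ⊓ φ b) (f : I → G) (t : LGroupTerm I) :
    φ (t.eval f) = t.eval fun i => φ (f i) := by
  induction t with
  | of i => rfl
  | zero => exact map_zero φ
  | add s t ihs iht => exact (map_add φ _ _).trans (congrArg₂ _ ihs iht)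
  | neg t ih => exact (map_neg φ _).trans (congrArg _ ih)
  | sup s t ihs iht => exact (hsup _ _).trans (congrArg₂ _ ihs iht)
  | inf s t ihs iht => exact (hinf _ _).trans (congrArg₂ _ ihs iht)

end HomEval

namespace LGroupTerm

/-- The element of the free Abelian ℓ-group represented by a term. -/
def toFree {I : Type*} (t : LGroupTerm I) : FreeAbelianLGroup I := t.eval FreeAbelianLGroup.of

theorem toFree_surjective {I : Type*} (x : FreeAbelianLGroup I) :
    ∃ t : LGroupTerm I, t.toFree = x := by
  obtain ⟨t, rfl⟩ := Quotient.exists_rep x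
  refine ⟨t, ?_⟩
  induction t with
  | of i => rfl
  | zero => rfl
  | add s t ihs iht => exact congrArg₂ (· + ·) ihs iht
  | neg t ih => exact congrArg (- ·) ih
  | sup s t ihs iht => exact congrArg₂ (· ⊔ ·) ihs iht
  | inf s t ihs iht => exact congrArg₂ (· ⊓ ·) ihs iht

theorem eval_le_eval_of_toFree_le {I H : Type*} [AddCommGroup H] [Lattice H]
    [IsOrderedAddMonoid H] {s t : LGroupTerm I} (h : s.toFree ≤ t.toFree) (f : I → H) :
    s.eval f ≤ t.eval f := by
  obtain ⟨φ, ⟨hsup, hinf, hof⟩, -⟩ := FreeAbelianLGroup.existsUnique_lift f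
  have key : ∀ r : LGroupTerm I, φ r.toFree = r.eval f := fun r => by
    rw [toFree, map_eval φ hsup hinf]
    simp only [hof]
  rw [← key s, ← key t, ← sup_eq_right, ← hsup, sup_eq_right.mpr h]

/-- Inequalities in the free Abelian ℓ-group may be tested in totally ordered groups. -/
theorem toFree_le_of_linearOrder {I : Type u} {s t : LGroupTerm I}
    (h : ∀ (H : Type u) [AddCommGroup H] [LinearOrder H] [IsOrderedAddMonoid H] (f : I → H),
      s.eval f ≤ t.eval f) : s.toFree ≤ t.toFree := by
  by_contra hst
  rw [← sub_nonpos] at hst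
  obtain ⟨H, _, _, _, φ, hsup, hinf, hφ⟩ := exists_linearOrder_hom hst
  rw [map_sub, sub_pos, toFree, toFree, map_eval φ hsup hinf, map_eval φ hsup hinf] at hφ
  exact hφ.not_ge (h H _)

variable {I : Type*}

/-- The set of variables of a term. -/
def vars : LGroupTerm I → Set I
  | .of i => {i}
  | .zero => ∅
  | .add s t => s.vars ∪ t.vars
  | .neg t => t.vars
  | .sup s t => s.vars ∪ t.vars
  | .inf s t => s.vars ∪ t.vars

theorem finite_vars (t : LGroupTerm I) : t.vars.Finite := by
  induction t with
  | of i => exact Set.finite_singleton i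
  | zero => exact Set.finite_empty
  | neg t ih => exact ih
  | add s t ihs iht | sup s t ihs iht | inf s t ihs iht => exact ihs.union iht

/-- Simultaneous substitution of terms for the variables of a term. -/
def subst {J : Type*} (θ : I → LGroupTerm J) : LGroupTerm I → LGroupTerm J
  | .of i => θ i
  | .zero => .zero
  | .add s t => (s.subst θ).add (t.subst θ)
  | .neg t => (t.subst θ).neg
  | .sup s t => (s.subst θ).sup (t.subst θ)
  | .inf s t => (s.subst θ).inf (t.subst θ)

theorem vars_subst_subset {J : Type*} {θ : I → LGroupTerm J} {t : LGroupTerm I} {S : Set J}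
    (h : ∀ i ∈ t.vars, (θ i).vars ⊆ S) : (t.subst θ).vars ⊆ S := by
  induction t with
  | of i => exact h i rfl
  | zero => exact Set.empty_subset S
  | neg t ih => exact ih h
  | add s t ihs iht | sup s t ihs iht | inf s t ihs iht =>
    exact Set.union_subset (ihs fun i hi => h i (Or.inl hi)) (iht fun i hi => h i (Or.inr hi))

/-- Multiples of a term by natural numbers. -/
def smulNat : ℕ → LGroupTerm I → LGroupTerm I
  | 0, _ => .zero
  | n + 1, t => (smulNat n t).add t

theorem vars_smulNat_subset (n : ℕ) (t : LGroupTerm I) : (smulNat n t).vars ⊆ t.vars := by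
  induction n with
  | zero => exact Set.empty_subset _
  | succ n ih => exact Set.union_subset ih subset_rfl

section Eval

variable {H : Type*} [AddCommGroup H] [Lattice H]

theorem eval_congr {f g : I → H} {t : LGroupTerm I} (h : ∀ i ∈ t.vars, f i = g i) :
    t.eval f = t.eval g := by
  induction t with
  | of i => exact h i rfl
  | zero => rfl
  | neg t ih => exact congrArg _ (ih h)
  | add s t ihs iht | sup s t ihs iht | inf s t ihs iht =>
    simp only [eval, ihs fun i hi => h i (Or.inl hi), iht fun i hi => h i (Or.inr hi)]

theorem eval_update [DecidableEq I] {f : I → H} {t : LGroupTerm I} {i : I} (hi : i ∉ t.vars)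
    (y : H) : t.eval (Function.update f i y) = t.eval f :=
  eval_congr fun _ hj => Function.update_of_ne (ne_of_mem_of_not_mem hj hi) y f

theorem eval_subst {J : Type*} (θ : I → LGroupTerm J) (f : J → H) (t : LGroupTerm I) :
    (t.subst θ).eval f = t.eval fun i => (θ i).eval f := by
  induction t with
  | of i => rfl
  | zero => rfl
  | neg t ih => exact congrArg _ ih
  | add s t ihs iht | sup s t ihs iht | inf s t ihs iht => exact congrArg₂ _ ihs iht

theorem eval_smulNat (n : ℕ) (t : LGroupTerm I) (f : I → H) :
    (smulNat n t).eval f = n • t.eval f := by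
  induction n with
  | zero => exact (zero_nsmul _).symm
  | succ n ih => rw [smulNat, eval, ih, succ_nsmul]

/-- The same term has to work in all groups at once, so that candidate points can later be given by
terms independent of the group. -/
theorem exists_eval_eq_zsmul (m : ℤ) (t : LGroupTerm I) :
    ∃ s : LGroupTerm I, s.vars ⊆ t.vars ∧
      ∀ {H : Type u} [AddCommGroup H] [Lattice H] (f : I → H), s.eval f = m • t.eval f := by
  obtain ⟨n, rfl | rfl⟩ := m.eq_nat_or_neg
  · exact ⟨smulNat n t, vars_smulNat_subset n t, fun f => by rw [eval_smulNat, natCast_zsmul]⟩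
  · exact ⟨(smulNat n t).neg, vars_smulNat_subset n t, fun f => by
      rw [eval, eval_smulNat, neg_zsmul, natCast_zsmul]⟩

end Eval

/-- On a chain, multiplication by `n` is monotone, hence a lattice homomorphism. This homogeneity is
what makes rescaling the variables harmless. -/
theorem eval_nsmul {H : Type*} [AddCommGroup H] [LinearOrder H] [IsOrderedAddMonoid H] (n : ℕ)
    (f : I → H) (t : LGroupTerm I) : (t.eval fun i => n • f i) = n • t.eval f := by
  have hmono : Monotone fun x : H => n • x := fun _ _ h => nsmul_le_nsmul_right h n
  exact (map_eval (nsmulAddMonoidHom n) (fun _ _ => hmono.map_sup _ _)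
    (fun _ _ => hmono.map_inf _ _) f t).symm

/-! ### Piecewise linearity and minimization over one variable -/

/-- Every term is piecewise linear in each variable: there are finitely many linear forms in the
variable, and the form that gives the value of the term depends only on the order of the values
of these forms. -/
theorem exists_linear_forms [DecidableEq I] (i : I) (t : LGroupTerm I) :
    ∃ A : Set (ℤ × LGroupTerm I), A.Finite ∧ A.Nonempty ∧ (∀ p ∈ A, p.2.vars ⊆ t.vars \ {i}) ∧
      ∀ {H : Type u} [AddCommGroup H] [LinearOrder H] [IsOrderedAddMonoid H] (f : I → H)
        (y : H), ∃ p ∈ A, ∀ z : H,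
          (∀ p ∈ A, ∀ q ∈ A, p.1 • y + p.2.eval f ≤ q.1 • y + q.2.eval f →
            p.1 • z + p.2.eval f ≤ q.1 • z + q.2.eval f) →
          t.eval (Function.update f i z) = p.1 • z + p.2.eval f := by
  induction t with
  | of j =>
    by_cases hj : j = i
    · subst hj
      refine ⟨{(1, .zero)}, Set.finite_singleton _, Set.singleton_nonempty _, ?_, ?_⟩
      · rintro _ rfl
        exact Set.empty_subset _
      · intro H _ _ _ f y
        exact ⟨_, rfl, fun z _ => by simp [eval]⟩
    · refine ⟨{(0, .of j)}, Set.finite_singleton _, Set.singleton_nonempty _, ?_, ?_⟩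
      · rintro _ rfl
        rintro _ rfl
        exact ⟨rfl, hj⟩
      · intro H _ _ _ f y
        exact ⟨_, rfl, fun z _ => by simp [eval, hj]⟩
  | zero =>
    refine ⟨{(0, .zero)}, Set.finite_singleton _, Set.singleton_nonempty _, ?_, ?_⟩
    · rintro _ rfl
      exact Set.empty_subset _
    · intro H _ _ _ f y
      exact ⟨_, rfl, fun z _ => by simp [eval]⟩
  | neg t ih =>
    obtain ⟨A, hA, hne, hv, h⟩ := ih
    refine ⟨(fun p => (-p.1, p.2.neg)) '' A, hA.image _, hne.image _, ?_, ?_⟩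
    · rintro _ ⟨p, hp, rfl⟩
      exact hv p hp
    · intro H _ _ _ f y
      have e : ∀ (k : ℤ) (x l : H), -k • x + -l = -(k • x + l) := fun k x l => by
        rw [neg_zsmul, neg_add]
      obtain ⟨p, hp, h1⟩ := h f y
      refine ⟨_, ⟨p, hp, rfl⟩, fun z hyz => ?_⟩
      simp only [eval, e]
      refine congrArg _ (h1 z fun p hp q hq hpq => ?_)
      have := hyz _ ⟨q, hq, rfl⟩ _ ⟨p, hp, rfl⟩
      simp only [eval, e, neg_le_neg_iff] at this
      exact this hpq
  | add s t ihs iht =>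
    obtain ⟨A, hA, hAne, hAv, hs⟩ := ihs
    obtain ⟨B, hB, hBne, hBv, ht⟩ := iht
    refine ⟨Set.image2 (fun p q => (p.1 + q.1, p.2.add q.2)) A B, hA.image2 _ hB,
      hAne.image2 hBne, ?_, ?_⟩
    · rintro _ ⟨p, hp, q, hq, rfl⟩
      exact Set.union_subset ((hAv p hp).trans (Set.sdiff_subset_sdiff_left Set.subset_union_left))
        ((hBv q hq).trans (Set.sdiff_subset_sdiff_left Set.subset_union_right))
    · intro H _ _ _ f y
      have e : ∀ (k m : ℤ) (x l r : H), (k + m) • x + (l + r) = (k • x + l) + (m • x + r) :=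
        fun k m x l r => by
          rw [add_zsmul]
          abel
      -- Adding a fixed form from the other family recovers the order within one family from the
      -- order of the sums; nonemptiness of the families is carried along for this.
      obtain ⟨a, ha⟩ := hAne
      obtain ⟨b, hb⟩ := hBne
      obtain ⟨p, hp, h1⟩ := hs f y
      obtain ⟨q, hq, h2⟩ := ht f y
      refine ⟨_, ⟨p, hp, q, hq, rfl⟩, fun z hyz => ?_⟩
      simp only [eval, e]
      refine congrArg₂ _ (h1 z fun p hp q hq hpq => ?_) (h2 z fun p hp q hq hpq => ?_)
      · have := hyz _ ⟨p, hp, b, hb, rfl⟩ _ ⟨q, hq, b, hb, rfl⟩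
        simp only [eval, e, add_le_add_iff_right] at this
        exact this hpq
      · have := hyz _ ⟨a, ha, p, hp, rfl⟩ _ ⟨a, ha, q, hq, rfl⟩
        simp only [eval, e, add_le_add_iff_left] at this
        exact this hpq
  | sup s t ihs iht =>
    obtain ⟨A, hA, hAne, hAv, hs⟩ := ihs
    obtain ⟨B, hB, hBne, hBv, ht⟩ := iht
    refine ⟨A ∪ B, hA.union hB, hAne.inl, ?_, ?_⟩
    · rintro p (hp | hp)
      · exact (hAv p hp).trans (Set.sdiff_subset_sdiff_left Set.subset_union_left)
      · exact (hBv p hp).trans (Set.sdiff_subset_sdiff_left Set.subset_union_right)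
    · intro H _ _ _ f y
      obtain ⟨p, hp, h1⟩ := hs f y
      obtain ⟨q, hq, h2⟩ := ht f y
      have key : ∀ z, (∀ p ∈ A ∪ B, ∀ q ∈ A ∪ B, p.1 • y + p.2.eval f ≤ q.1 • y + q.2.eval f →
          p.1 • z + p.2.eval f ≤ q.1 • z + q.2.eval f) →
          (s.sup t).eval (Function.update f i z) =
            (p.1 • z + p.2.eval f) ⊔ (q.1 • z + q.2.eval f) := fun z hyz =>
        congrArg₂ _ (h1 z fun p hp q hq => hyz p (Or.inl hp) q (Or.inl hq))
          (h2 z fun p hp q hq => hyz p (Or.inr hp) q (Or.inr hq))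
      -- The form that is larger at `y` stays larger at every `z` where the forms have the same
      -- order.
      rcases le_total (p.1 • y + p.2.eval f) (q.1 • y + q.2.eval f) with hpq | hpq
      · exact ⟨q, Or.inr hq, fun z hyz => (key z hyz).trans
          (sup_eq_right.mpr (hyz p (Or.inl hp) q (Or.inr hq) hpq))⟩
      · exact ⟨p, Or.inl hp, fun z hyz => (key z hyz).trans
          (sup_eq_left.mpr (hyz q (Or.inr hq) p (Or.inl hp) hpq))⟩
  | inf s t ihs iht =>
    obtain ⟨A, hA, hAne, hAv, hs⟩ := ihs
    obtain ⟨B, hB, hBne, hBv, ht⟩ := iht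
    refine ⟨A ∪ B, hA.union hB, hAne.inl, ?_, ?_⟩
    · rintro p (hp | hp)
      · exact (hAv p hp).trans (Set.sdiff_subset_sdiff_left Set.subset_union_left)
      · exact (hBv p hp).trans (Set.sdiff_subset_sdiff_left Set.subset_union_right)
    · intro H _ _ _ f y
      obtain ⟨p, hp, h1⟩ := hs f y
      obtain ⟨q, hq, h2⟩ := ht f y
      have key : ∀ z, (∀ p ∈ A ∪ B, ∀ q ∈ A ∪ B, p.1 • y + p.2.eval f ≤ q.1 • y + q.2.eval f →
          p.1 • z + p.2.eval f ≤ q.1 • z + q.2.eval f) →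
          (s.inf t).eval (Function.update f i z) =
            (p.1 • z + p.2.eval f) ⊓ (q.1 • z + q.2.eval f) := fun z hyz =>
        congrArg₂ _ (h1 z fun p hp q hq => hyz p (Or.inl hp) q (Or.inl hq))
          (h2 z fun p hp q hq => hyz p (Or.inr hp) q (Or.inr hq))
      rcases le_total (p.1 • y + p.2.eval f) (q.1 • y + q.2.eval f) with hpq | hpq
      · exact ⟨p, Or.inl hp, fun z hyz => (key z hyz).trans
          (inf_eq_left.mpr (hyz p (Or.inl hp) q (Or.inr hq) hpq))⟩
      · exact ⟨q, Or.inr hq, fun z hyz => (key z hyz).trans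
          (inf_eq_right.mpr (hyz q (Or.inr hq) p (Or.inl hp) hpq))⟩

end LGroupTerm

/-- Used for the differences of slopes, by which one must divide to locate crossing points. -/
theorem exists_pos_common_multiple {B : Set ℤ} (hB : B.Finite) :
    ∃ N : ℕ, 0 < N ∧ ∀ k ∈ B, k ≠ 0 → ∃ m : ℤ, k * m = N := by
  induction B, hB using Set.Finite.induction_on with
  | empty => exact ⟨1, one_pos, fun k hk => hk.elim⟩
  | @insert a s _ _ ih =>
    obtain ⟨N, hN, h⟩ := ih
    by_cases ha : a = 0
    · refine ⟨N, hN, ?_⟩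
      rintro k (rfl | hk) hk0
      · exact (hk0 ha).elim
      · exact h k hk hk0
    · refine ⟨N * a.natAbs, Nat.mul_pos hN (Int.natAbs_pos.mpr ha), ?_⟩
      rintro k (rfl | hk) hk0
      · obtain ⟨m, hm⟩ : k ∣ (k.natAbs : ℤ) := Int.dvd_natAbs.mpr dvd_rfl
        exact ⟨N * m, by push_cast; rw [mul_left_comm, ← hm, Int.natCast_natAbs]⟩
      · obtain ⟨m, hm⟩ := h k hk hk0
        exact ⟨m * a.natAbs, by rw [← mul_assoc, hm]; push_cast; rfl⟩

/-- If two affine functions change their order strictly between `y` and `z`, then they cross at a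
point that lies between `y` and `z`, distinct from `z`. -/
theorem between_of_zsmul_add_pos {H : Type*} [AddCommGroup H] [LinearOrder H]
    [IsOrderedAddMonoid H] {k : ℤ} {e w y z : H} (hw : k ≠ 0 → k • w = -e)
    (hy : k • y + e ≤ 0) (hz : 0 < k • z + e) :
    y ≤ w ∧ w < z ∨ z < w ∧ w ≤ y := by
  rw [← le_neg_iff_add_nonpos_right] at hy
  rw [← neg_lt_iff_pos_add] at hz
  rcases lt_trichotomy k 0 with hk | rfl | hk
  · rw [← hw hk.ne] at hy hz
    right
    constructor
    · rw [← zsmul_lt_zsmul_iff_right (neg_pos.mpr hk), neg_zsmul, neg_zsmul]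
      exact neg_lt_neg hz
    · rw [← zsmul_le_zsmul_iff_right (neg_pos.mpr hk), neg_zsmul, neg_zsmul]
      exact neg_le_neg hy
  · rw [zero_zsmul] at hy hz
    exact (hy.not_gt hz).elim
  · rw [← hw hk.ne'] at hy hz
    exact Or.inl ⟨(zsmul_le_zsmul_iff_right hk).mp hy, (zsmul_lt_zsmul_iff_right hk).mp hz⟩

namespace LGroupTerm

variable {I : Type*}

/-- After rescaling the other variables, a term that is bounded below as a function of the
variable `i` attains its minimum at one of finitely many points, which are given by terms in the
other variables. -/
theorem exists_min_points [DecidableEq I] (i : I) (t : LGroupTerm I) :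
    ∃ N : ℕ, 0 < N ∧ ∃ P : Set (LGroupTerm I), P.Finite ∧ P.Nonempty ∧
      (∀ p ∈ P, p.vars ⊆ t.vars \ {i}) ∧
      ∀ {H : Type u} [AddCommGroup H] [LinearOrder H] [IsOrderedAddMonoid H] (f : I → H) (g : H),
        (∀ z, g ≤ t.eval (Function.update (fun j => N • f j) i z)) →
        ∀ y, ∃ p ∈ P, t.eval (Function.update (fun j => N • f j) i (p.eval f)) ≤
          t.eval (Function.update (fun j => N • f j) i y) := by
  obtain ⟨A, hA, -, hAv, hform⟩ := exists_linear_forms.{_, u} i t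
  obtain ⟨N, hN, hdvd⟩ := exists_pos_common_multiple
    (hA.image2 (fun p q : ℤ × LGroupTerm I => p.1 - q.1) hA)
  -- After rescaling by `N`, the crossing point of two forms of different slopes is an integral
  -- combination of their constant parts: the multiplier is `N` divided by the difference of slopes.
  have hpt : ∀ p ∈ A, ∀ q ∈ A, ∃ w : LGroupTerm I, w.vars ⊆ t.vars \ {i} ∧
      ∀ {H : Type u} [AddCommGroup H] [LinearOrder H] [IsOrderedAddMonoid H] (f : I → H),
        p.1 - q.1 ≠ 0 → (p.1 - q.1) • w.eval f =
          -((p.2.eval fun j => N • f j) - q.2.eval fun j => N • f j) := by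
    intro p hp q hq
    by_cases hpq : p.1 - q.1 = 0
    · exact ⟨.zero, Set.empty_subset _, fun f h => (h hpq).elim⟩
    · obtain ⟨m, hm⟩ := hdvd _ ⟨p, hp, q, hq, rfl⟩ hpq
      have hm : (p.1 - q.1) * m = N := hm
      obtain ⟨w, hwv, hw⟩ := exists_eval_eq_zsmul.{_, u} m (q.2.add p.2.neg)
      refine ⟨w, hwv.trans (Set.union_subset (hAv q hq) (hAv p hp)), fun f _ => ?_⟩
      rw [hw, smul_smul, hm, neg_sub, eval_nsmul, eval_nsmul, natCast_zsmul, ← nsmul_sub,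
        eval, eval, sub_eq_add_neg]
  have : Nonempty (LGroupTerm I) := ⟨.zero⟩
  choose! w hwv hw using hpt
  -- Zero is added as a reference point: it makes the set nonempty and yields a strictly positive
  -- length when all candidates lie on one side of `y`.
  refine ⟨N, hN, insert .zero (Set.image2 w A A), (hA.image2 w hA).insert _,
    Set.insert_nonempty _ _, ?_, ?_⟩
  · rintro _ (rfl | ⟨p, hp, q, hq, rfl⟩)
    · exact Set.empty_subset _
    · exact hwv p hp q hq
  intro H _ _ _ f g hg y
  have hP := (hA.image2 w hA).insert LGroupTerm.zero
  have hP0 : LGroupTerm.zero ∈ insert LGroupTerm.zero (Set.image2 w A A) := Set.mem_insert _ _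
  have hPw : ∀ p ∈ A, ∀ q ∈ A, w p q ∈ insert LGroupTerm.zero (Set.image2 w A A) :=
    fun p hp q hq => Or.inr ⟨p, hp, q, hq, rfl⟩
  generalize insert LGroupTerm.zero (Set.image2 w A A) = P at hP hP0 hPw
  set F : I → H := fun j => N • f j with hF
  obtain ⟨⟨k, l⟩, ha, hval⟩ := hform F y
  -- While no candidate separates `z` from `y`, no two forms change their order, so the form valid
  -- at `y` remains valid at `z`. The endpoint `z` may itself be a candidate.
  have hseg : ∀ z, (∀ p ∈ P, ¬ (y ≤ p.eval f ∧ p.eval f < z) ∧ ¬ (z < p.eval f ∧ p.eval f ≤ y)) →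
      t.eval (Function.update F i z) = k • z + l.eval F := by
    intro z hz
    refine hval z fun p hp q hq hpq => ?_
    by_contra! hlt
    have e : ∀ x : H, (p.1 - q.1) • x + (p.2.eval F - q.2.eval F) =
        (p.1 • x + p.2.eval F) - (q.1 • x + q.2.eval F) := fun x => by
      rw [sub_zsmul]
      abel
    rcases between_of_zsmul_add_pos (hw p hp q hq f) ((e y).trans_le (sub_nonpos.mpr hpq))
      ((sub_pos.mpr hlt).trans_eq (e z).symm) with h | h
    · exact (hz _ (hPw p hp q hq)).1 h
    · exact (hz _ (hPw p hp q hq)).2 h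
  have hy : t.eval (Function.update F i y) = k • y + l.eval F :=
    hseg y fun p _ => ⟨fun h => h.1.not_gt h.2, fun h => h.2.not_gt h.1⟩
  have hgy : 0 ≤ k • y + l.eval F - g := sub_nonneg.mpr (hy ▸ hg y)
  -- With nonnegative slope, sliding left to the nearest candidate does not increase the value; `h2`
  -- below is the mirror case.
  by_cases h1 : 0 ≤ k ∧ ∃ p ∈ P, p.eval f ≤ y
  · obtain ⟨u, ⟨huP, huy⟩, hu⟩ := Set.Finite.exists_maximalFor (fun p : LGroupTerm I => p.eval f)
      {p ∈ P | p.eval f ≤ y} (hP.subset fun p hp => hp.1) h1.2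
    refine ⟨u, huP, ?_⟩
    rw [hy, hseg (u.eval f) fun p hp => ⟨fun h => (h.1.trans_lt h.2).not_ge huy,
      fun h => h.1.not_ge (hu ⟨hp, h.2⟩ h.1.le)⟩]
    exact add_le_add_left (zsmul_le_zsmul_right h1.1 huy) _
  by_cases h2 : 0 ≤ -k ∧ ∃ p ∈ P, y ≤ p.eval f
  · obtain ⟨v, ⟨hvP, hvy⟩, hv⟩ := Set.Finite.exists_minimalFor
      (fun p : LGroupTerm I => p.eval f) {p ∈ P | y ≤ p.eval f} (hP.subset fun p hp => hp.1) h2.2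
    refine ⟨v, hvP, ?_⟩
    rw [hy, hseg (v.eval f) fun p hp => ⟨fun h => h.2.not_ge (hv ⟨hp, h.1⟩ h.2.le),
      fun h => (h.1.trans_le h.2).not_ge hvy⟩]
    have := zsmul_le_zsmul_right h2.1 hvy
    rw [neg_zsmul, neg_zsmul, neg_le_neg_iff] at this
    exact add_le_add_left this _
  -- In the remaining case the value decreases in a direction without candidates, so the same form
  -- holds along a whole ray. The slope has absolute value at least `1`, and moving by the gap above
  -- `g` plus the distance from `y` to zero brings the value below `g`.
  exfalso
  push Not at h1 h2
  have hsum : ∀ d : H, t.eval (Function.update F i (y + d)) = k • (y + d) + l.eval F →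
      0 ≤ (k • y + l.eval F - g) + k • d := fun d hd => by
    have h := sub_nonneg.mpr (hg (y + d))
    rw [hd, zsmul_add] at h
    exact h.trans_eq (by abel)
  have hz : LGroupTerm.zero.eval f = (0 : H) := rfl
  rcases le_total 0 k with hk | hk
  · have hpos := h1 hk
    have hy0 : 0 < -y := neg_pos.mpr (hz ▸ hpos _ hP0)
    have hk1 : 1 ≤ k := by
      rcases hk.eq_or_lt with rfl | hk
      · exact ((h2 (by simp) _ hP0).not_gt (hpos _ hP0)).elim
      · exact hk
    have hd : 0 ≤ (k • y + l.eval F - g) + -y := add_nonneg hgy hy0.le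
    have h := hsum _ (hseg _ fun p hp => ⟨fun h =>
      (h.1.trans_lt h.2).not_ge (add_le_of_nonpos_right (neg_nonpos.mpr hd)),
      fun h => (hpos p hp).not_ge h.2⟩)
    have h3 := zsmul_le_zsmul_left hd hk1
    rw [one_zsmul] at h3
    rw [zsmul_neg, ← sub_eq_add_neg, sub_nonneg] at h
    exact (h3.trans h).not_gt (lt_add_of_pos_right _ hy0)
  · have hpos := h2 (neg_nonneg.mpr hk)
    have hy0 : 0 < y := hz ▸ hpos _ hP0
    have hk1 : 1 ≤ -k := by
      rcases hk.eq_or_lt with rfl | hk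
      · exact ((h1 le_rfl _ hP0).not_gt (hpos _ hP0)).elim
      · exact neg_pos.mpr hk
    have hd : 0 ≤ (k • y + l.eval F - g) + y := add_nonneg hgy hy0.le
    have h := hsum _ (hseg _ fun p hp => ⟨fun h => (hpos p hp).not_ge h.1,
      fun h => (h.1.trans_le h.2).not_ge (le_add_of_nonneg_right hd)⟩)
    have h3 := zsmul_le_zsmul_left hd hk1
    rw [one_zsmul, neg_zsmul] at h3
    rw [← sub_neg_eq_add, sub_nonneg] at h
    exact (h3.trans h).not_gt (lt_add_of_pos_right _ hy0)

/-- A finite nonempty set of terms has a meet among terms. -/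
theorem exists_term_inf {P : Set (LGroupTerm I)} (hP : P.Finite) (hne : P.Nonempty) {S : Set I}
    (hS : ∀ p ∈ P, p.vars ⊆ S) :
    ∃ c : LGroupTerm I, c.vars ⊆ S ∧
      ∀ {H : Type u} [AddCommGroup H] [LinearOrder H] (f : I → H),
        (∃ p ∈ P, c.eval f = p.eval f) ∧ ∀ p ∈ P, c.eval f ≤ p.eval f := by
  induction P, hP using Set.Finite.induction_on with
  | empty => exact hne.elim fun _ h => h.elim
  | @insert a s _ _ ih =>
    rcases s.eq_empty_or_nonempty with rfl | hs
    · refine ⟨a, hS a (Set.mem_insert _ _), fun f => ⟨⟨a, Set.mem_insert _ _, rfl⟩, ?_⟩⟩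
      rintro p (rfl | hp)
      exacts [le_rfl, hp.elim]
    · obtain ⟨c, hcS, hc⟩ := ih hs fun p hp => hS p (Or.inr hp)
      refine ⟨a.inf c, Set.union_subset (hS a (Or.inl rfl)) hcS, fun {H} _ _ f => ⟨?_, ?_⟩⟩
      · rcases le_total (a.eval f) (c.eval f) with h | h
        · exact ⟨a, Or.inl rfl, inf_eq_left.mpr h⟩
        · obtain ⟨p, hp, e⟩ := (hc f).1
          exact ⟨p, Or.inr hp, (inf_eq_right.mpr h).trans e⟩
      · rintro p (rfl | hp)
        · exact inf_le_left
        · exact inf_le_right.trans ((hc f).2 p hp)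

/-- The minimum of a term over the values of one variable, up to rescaling, is given by a term in
the other variables. -/
theorem exists_min_term [DecidableEq I] (i : I) (t : LGroupTerm I) :
    ∃ N : ℕ, 0 < N ∧ ∃ c : LGroupTerm I, c.vars ⊆ t.vars \ {i} ∧
      ∀ {H : Type u} [AddCommGroup H] [LinearOrder H] [IsOrderedAddMonoid H] (f : I → H),
        (∃ x, c.eval f = t.eval (Function.update (fun j => N • f j) i x)) ∧
        ((∃ g, ∀ z, g ≤ t.eval (Function.update (fun j => N • f j) i z)) →
          c.eval f ≤ N • t.eval f) := by
  obtain ⟨N, hN, P, hP, hne, hPv, hmin⟩ := exists_min_points.{_, u} i t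
  -- Substituting a candidate for `i` and `N` times each other variable turns the value at that
  -- candidate into a term; `c` is the meet of these terms.
  set θ : LGroupTerm I → I → LGroupTerm I :=
    fun p => Function.update (fun j => smulNat N (.of j)) i p with hθ
  have hvars : ∀ q ∈ (fun p => t.subst (θ p)) '' P, q.vars ⊆ t.vars \ {i} := by
    rintro _ ⟨p, hp, rfl⟩
    refine vars_subst_subset fun j hj => ?_
    by_cases hji : j = i
    · subst hji
      simpa [θ] using hPv p hp
    · simp only [θ, Function.update_of_ne hji]
      refine (vars_smulNat_subset _ _).trans ?_
      rintro _ rfl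
      exact ⟨hj, hji⟩
  have heval : ∀ {H : Type u} [AddCommGroup H] [Lattice H] (f : I → H) (p : LGroupTerm I),
      (t.subst (θ p)).eval f = t.eval (Function.update (fun j => N • f j) i (p.eval f)) := by
    intro H _ _ f p
    rw [eval_subst]
    congr 1
    funext j
    by_cases hji : j = i
    · subst hji
      simp [θ]
    · simp only [θ, Function.update_of_ne hji, eval_smulNat, eval]
  obtain ⟨c, hcv, hc⟩ := exists_term_inf.{_, u} (hP.image _) (hne.image _) hvars
  refine ⟨N, hN, c, hcv, fun {H} _ _ _ f => ⟨?_, ?_⟩⟩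
  · obtain ⟨_, ⟨p, -, rfl⟩, e⟩ := (hc f).1
    exact ⟨_, e.trans (heval f p)⟩
  · rintro ⟨g, hg⟩
    -- At `N • f i` the updated assignment is `N • f` itself, and homogeneity applies.
    obtain ⟨p, hp, h⟩ := hmin f g hg (N • f i)
    refine ((hc f).2 _ ⟨p, hp, rfl⟩).trans ((heval f p).trans_le (h.trans_eq ?_))
    rw [← eval_nsmul]
    congr 1
    exact Function.update_eq_self i _

end LGroupTerm

/-! ### Floors and ceilings of principal ℓ-ideals -/

namespace LGroupTerm

variable {I : Type*}

/-- The principal ℓ-ideal generated by the element that a term represents. -/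
def toIdeal (t : LGroupTerm I) : PrincipalLIdeal (FreeAbelianLGroup I) :=
  ⟨lIdealSpan t.toFree, t.toFree, rfl⟩

theorem toFree_smulNat (n : ℕ) (t : LGroupTerm I) : (smulNat n t).toFree = n • t.toFree :=
  eval_smulNat n t _

theorem toIdeal_le_toIdeal {s t : LGroupTerm I} (hs : 0 ≤ s.toFree) (ht : 0 ≤ t.toFree) :
    s.toIdeal ≤ t.toIdeal ↔ ∃ n : ℕ, s.toFree ≤ n • t.toFree := by
  refine (lIdealSpan_le (isLIdeal_lIdealSpan _)).trans (mem_lIdealSpan.trans ?_)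
  rw [abs_of_nonneg hs, abs_of_nonneg ht]

theorem toIdeal_le_of_toFree_le_smulNat {s t : LGroupTerm I} (hs : 0 ≤ s.toFree)
    (ht : 0 ≤ t.toFree) {n : ℕ} (h : s.toFree ≤ (smulNat n t).toFree) :
    s.toIdeal ≤ t.toIdeal :=
  (toIdeal_le_toIdeal hs ht).mpr ⟨n, h.trans_eq (toFree_smulNat n t)⟩

theorem exists_toFree_le_smulNat {s t : LGroupTerm I} (hs : 0 ≤ s.toFree)
    (ht : 0 ≤ t.toFree) (h : s.toIdeal ≤ t.toIdeal) :
    ∃ n : ℕ, s.toFree ≤ (smulNat n t).toFree :=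
  ((toIdeal_le_toIdeal hs ht).mp h).imp fun n hn => hn.trans_eq (toFree_smulNat n t).symm

theorem toFree_nonneg_iff {t : LGroupTerm I} :
    0 ≤ t.toFree ↔ (zero : LGroupTerm I).toFree ≤ t.toFree := Iff.rfl

theorem eval_nonneg {H : Type*} [AddCommGroup H] [Lattice H] [IsOrderedAddMonoid H]
    {t : LGroupTerm I} (ht : 0 ≤ t.toFree) (f : I → H) : 0 ≤ t.eval f :=
  eval_le_eval_of_toFree_le (toFree_nonneg_iff.mp ht) f

end LGroupTerm

open LGroupTerm

/-- A principal ℓ-ideal of the free Abelian ℓ-group is supported on a set `S` of variables if it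
is generated by a positive term in these variables. -/
def PrincipalLIdeal.IsSupported {I : Type*} (S : Set I)
    (J : PrincipalLIdeal (FreeAbelianLGroup I)) : Prop :=
  ∃ t : LGroupTerm I, t.vars ⊆ S ∧ 0 ≤ t.toFree ∧ t.toIdeal = J

namespace PrincipalLIdeal

variable {I : Type*} {S : Set I} {J : PrincipalLIdeal (FreeAbelianLGroup I)}

theorem exists_isSupported (J : PrincipalLIdeal (FreeAbelianLGroup I)) :
    ∃ S : Finset I, J.IsSupported (S : Set I) := by
  obtain ⟨_, a, rfl⟩ := J
  obtain ⟨t, ht⟩ := toFree_surjective |a|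
  refine ⟨t.finite_vars.toFinset, t, by simp, ht ▸ abs_nonneg a, Subtype.ext ?_⟩
  have h : ∀ x, x ∈ lIdealSpan |a| ↔ x ∈ lIdealSpan a := fun x => by
    rw [mem_lIdealSpan, mem_lIdealSpan, abs_abs]
  change lIdealSpan t.toFree = lIdealSpan a
  rw [ht]
  exact AddSubgroup.ext h

/-- Among the ℓ-ideals not depending on the variable `i`, there is a largest one below `J`. -/
theorem exists_floor (i : I) (hJ : J.IsSupported S) :
    ∃ C : PrincipalLIdeal (FreeAbelianLGroup I), C.IsSupported (S \ {i}) ∧ C ≤ J ∧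
      ∀ K T, K.IsSupported T → i ∉ T → K ≤ J → K ≤ C := by
  classical
  obtain ⟨t, htS, ht0, rfl⟩ := hJ
  obtain ⟨N, hN, c, hcv, hc⟩ := exists_min_term i t
  have hc0 : 0 ≤ c.toFree := toFree_nonneg_iff.mpr <| toFree_le_of_linearOrder fun H _ _ _ f => by
    obtain ⟨x, hx⟩ := (hc f).1
    rw [hx]
    exact eval_nonneg ht0 _
  refine ⟨c.toIdeal, ⟨c, hcv.trans (Set.sdiff_subset_sdiff_left htS), hc0, rfl⟩, ?_, ?_⟩
  · refine toIdeal_le_of_toFree_le_smulNat hc0 ht0 (n := N) ?_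
    refine toFree_le_of_linearOrder fun H _ _ _ f => ?_
    rw [eval_smulNat]
    exact (hc f).2 ⟨0, fun z => eval_nonneg ht0 _⟩
  · rintro _ T ⟨s, hsT, hs0, rfl⟩ hi h
    obtain ⟨n, hn⟩ := exists_toFree_le_smulNat hs0 ht0 h
    refine toIdeal_le_of_toFree_le_smulNat hs0 hc0 (n := n) ?_
    refine toFree_le_of_linearOrder fun H _ _ _ f => ?_
    obtain ⟨x, hx⟩ := (hc f).1
    -- Evaluating at a point where `t` takes the value of `c` leaves `s` unaffected apart from the
    -- factor `N`, because `s` does not involve `i`.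
    have h1 := eval_le_eval_of_toFree_le hn (Function.update (fun j => N • f j) i x)
    rw [eval_update fun h => hi (hsT h), eval_nsmul, eval_smulNat, ← hx] at h1
    rw [eval_smulNat]
    exact (le_self_nsmul (eval_nonneg hs0 f) hN.ne').trans h1

/-- Among the ℓ-ideals not depending on the variable `i`, there is a least one above `J`, provided
that there is any. -/
theorem exists_ceil (i : I) (hJ : J.IsSupported S) :
    ∃ C : PrincipalLIdeal (FreeAbelianLGroup I), C.IsSupported (S \ {i}) ∧
      ∀ K T, K.IsSupported T → i ∉ T → J ≤ K → J ≤ C ∧ C ≤ K := by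
  classical
  obtain ⟨t, htS, ht0, rfl⟩ := hJ
  -- The maximum of `t` over `i` is minus the minimum of `-t`.
  obtain ⟨N, hN, c, hcv, hc⟩ := exists_min_term i t.neg
  have hc0 : 0 ≤ c.neg.toFree :=
    toFree_nonneg_iff.mpr <| toFree_le_of_linearOrder fun H _ _ _ f => by
      obtain ⟨x, hx⟩ := (hc f).1
      change 0 ≤ -c.eval f
      rw [hx, eval, neg_neg]
      exact eval_nonneg ht0 _
  refine ⟨c.neg.toIdeal, ⟨c.neg, hcv.trans (Set.sdiff_subset_sdiff_left htS), hc0, rfl⟩, ?_⟩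
  rintro _ T ⟨s, hsT, hs0, rfl⟩ hi h
  obtain ⟨n, hn⟩ := exists_toFree_le_smulNat ht0 hs0 h
  -- An upper bound free of `i` bounds `t` uniformly in that variable, so `-t` is bounded below and
  -- its minimum is available.
  have key : ∀ {H : Type _} [AddCommGroup H] [LinearOrder H] [IsOrderedAddMonoid H] (f : I → H)
      (x : H), t.eval (Function.update (fun j => N • f j) i x) ≤ n • N • s.eval f := by
    intro H _ _ _ f x
    have h1 := eval_le_eval_of_toFree_le hn (Function.update (fun j => N • f j) i x)
    rwa [eval_smulNat, eval_update fun h => hi (hsT h), eval_nsmul] at h1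
  constructor
  · refine toIdeal_le_of_toFree_le_smulNat ht0 hc0 (n := 1) ?_
    refine toFree_le_of_linearOrder fun H _ _ _ f => ?_
    have h1 := (hc f).2 ⟨-(n • N • s.eval f), fun z => neg_le_neg (key f z)⟩
    rw [eval, smul_neg, le_neg] at h1
    rw [eval_smulNat, one_nsmul, eval]
    exact (le_self_nsmul (eval_nonneg ht0 f) hN.ne').trans h1
  · refine toIdeal_le_of_toFree_le_smulNat hc0 hs0 (n := n * N) ?_
    refine toFree_le_of_linearOrder fun H _ _ _ f => ?_
    obtain ⟨x, hx⟩ := (hc f).1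
    rw [eval, hx, eval, neg_neg, eval_smulNat, mul_nsmul']
    exact key f x

theorem exists_floor_of_finite {E : Set I} (hE : E.Finite) (hJ : J.IsSupported S) :
    ∃ C : PrincipalLIdeal (FreeAbelianLGroup I), C.IsSupported (S \ E) ∧ C ≤ J ∧
      ∀ K T, K.IsSupported T → Disjoint E T → K ≤ J → K ≤ C := by
  induction E, hE using Set.Finite.induction_on with
  | empty => exact ⟨J, by rwa [Set.sdiff_empty], le_rfl, fun K T _ _ h => h⟩
  | @insert i E _ _ ih =>
    obtain ⟨C, hC, hCJ, h⟩ := ih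
    obtain ⟨C', hC', hCC', h'⟩ := exists_floor i hC
    refine ⟨C', ?_, hCC'.trans hCJ, fun K T hK hT hKJ => ?_⟩
    · rwa [Set.sdiff_sdiff, Set.union_singleton] at hC'
    · rw [Set.disjoint_insert_left] at hT
      exact h' K T hK hT.1 (h K T hK hT.2 hKJ)

/-- An upper bound `K` avoiding all of `E` also lies above the ceiling reached so far, and so
supplies the bound needed for eliminating the next variable. -/
theorem exists_ceil_of_finite {E : Set I} (hE : E.Finite) (hJ : J.IsSupported S) :
    ∃ C : PrincipalLIdeal (FreeAbelianLGroup I), C.IsSupported (S \ E) ∧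
      ∀ K T, K.IsSupported T → Disjoint E T → J ≤ K → J ≤ C ∧ C ≤ K := by
  induction E, hE using Set.Finite.induction_on with
  | empty => exact ⟨J, by rwa [Set.sdiff_empty], fun K T _ _ h => ⟨le_rfl, h⟩⟩
  | @insert i E _ _ ih =>
    obtain ⟨C, hC, h⟩ := ih
    obtain ⟨C', hC', h'⟩ := exists_ceil i hC
    refine ⟨C', ?_, fun K T hK hT hKJ => ?_⟩
    · rwa [Set.sdiff_sdiff, Set.union_singleton] at hC'
    · rw [Set.disjoint_insert_left] at hT
      obtain ⟨h1, h2⟩ := h K T hK hT.2 hKJ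
      obtain ⟨h3, h4⟩ := h' K T hK hT.1 h2
      exact ⟨h1.trans h3, h4⟩

end PrincipalLIdeal

/-! ### Countability of the ideals with a given countable support -/

namespace LGroupTerm

/-- There are only countably many terms over a countable set of variables. -/
theorem countable_vars_subset {I : Type*} {S : Set I} (hS : S.Countable) :
    {t : LGroupTerm I | t.vars ⊆ S}.Countable := by
  let step : Set (LGroupTerm I) → Set (LGroupTerm I) := fun X =>
    X ∪ (Set.image2 add X X ∪ (neg '' X ∪ (Set.image2 sup X X ∪ Set.image2 inf X X)))
  let X : ℕ → Set (LGroupTerm I) := fun n => step^[n] (insert zero (of '' S))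
  have hsucc : ∀ n, X (n + 1) = step (X n) := fun n => Function.iterate_succ_apply' _ _ _
  have hX : ∀ n, (X n).Countable := by
    intro n
    induction n with
    | zero => exact (hS.image _).insert _
    | succ n ih =>
      rw [hsucc]
      exact ih.union ((ih.image2 ih _).union ((ih.image _).union
        ((ih.image2 ih _).union (ih.image2 ih _))))
  have hmono : Monotone X := monotone_nat_of_le_succ fun n => by
    rw [hsucc]
    exact Set.subset_union_left
  refine (Set.countable_iUnion hX).mono fun t ht => Set.mem_iUnion.mpr ?_
  have hbin : ∀ {s t : LGroupTerm I}, (∃ n, s ∈ X n) → (∃ n, t ∈ X n) →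
      ∃ n, s ∈ X n ∧ t ∈ X n := by
    rintro s t ⟨n, hn⟩ ⟨m, hm⟩
    exact ⟨max n m, hmono (le_max_left n m) hn, hmono (le_max_right n m) hm⟩
  induction t with
  | of i => exact ⟨0, Or.inr ⟨i, ht rfl, rfl⟩⟩
  | zero => exact ⟨0, Or.inl rfl⟩
  | neg t ih =>
    obtain ⟨n, hn⟩ := ih ht
    exact ⟨n + 1, hsucc n ▸ Or.inr (Or.inr (Or.inl ⟨t, hn, rfl⟩))⟩
  | add s t ihs iht =>
    obtain ⟨n, h1, h2⟩ := hbin (ihs fun i hi => ht (Or.inl hi)) (iht fun i hi => ht (Or.inr hi))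
    exact ⟨n + 1, hsucc n ▸ Or.inr (Or.inl ⟨s, h1, t, h2, rfl⟩)⟩
  | sup s t ihs iht =>
    obtain ⟨n, h1, h2⟩ := hbin (ihs fun i hi => ht (Or.inl hi)) (iht fun i hi => ht (Or.inr hi))
    exact ⟨n + 1, hsucc n ▸ Or.inr (Or.inr (Or.inr (Or.inl ⟨s, h1, t, h2, rfl⟩)))⟩
  | inf s t ihs iht =>
    obtain ⟨n, h1, h2⟩ := hbin (ihs fun i hi => ht (Or.inl hi)) (iht fun i hi => ht (Or.inr hi))
    exact ⟨n + 1, hsucc n ▸ Or.inr (Or.inr (Or.inr (Or.inr ⟨s, h1, t, h2, rfl⟩)))⟩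

end LGroupTerm

theorem PrincipalLIdeal.countable_isSupported {I : Type*} {S : Set I} (hS : S.Countable) :
    {J : PrincipalLIdeal (FreeAbelianLGroup I) | J.IsSupported S}.Countable := by
  refine ((countable_vars_subset hS).image toIdeal).mono ?_
  rintro _ ⟨t, ht, -, rfl⟩
  exact ⟨t, ht, rfl⟩

/-! ### Isotone sections by transfinite recursion -/

section MonotoneSection

variable {L D : Type*} [Lattice L] [Lattice D] {f : L → D}

/-- Joining `a` with those `σ M` for which `M ≤ J` does not change the image. -/
theorem exists_preimage_ge (hsup : ∀ a b, f (a ⊔ b) = f a ⊔ f b) {σ : D → L} {A : Set D}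
    (hA : A.Finite) (hσ : ∀ M ∈ A, f (σ M) = M) {J : D} (a : L) (ha : f a = J) :
    ∃ b, f b = J ∧ ∀ M ∈ A, M ≤ J → σ M ≤ b := by
  induction A, hA using Set.Finite.induction_on with
  | empty => exact ⟨a, ha, fun _ h => h.elim⟩
  | @insert K A _ _ ih =>
    obtain ⟨b, hb, h⟩ := ih fun M hM => hσ M (Or.inr hM)
    by_cases hK : K ≤ J
    · refine ⟨b ⊔ σ K, ?_, ?_⟩
      · rw [hsup, hb, hσ K (Or.inl rfl), sup_eq_left.mpr hK]
      · rintro M (rfl | hM) hMJ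
        exacts [le_sup_right, (h M hM hMJ).trans le_sup_left]
    · refine ⟨b, hb, ?_⟩
      rintro M (rfl | hM) hMJ
      exacts [(hK hMJ).elim, h M hM hMJ]

/-- Dually, take meets. The last clause ensures that lower bounds secured beforehand survive. -/
theorem exists_preimage_le (hinf : ∀ a b, f (a ⊓ b) = f a ⊓ f b) {σ : D → L} {A : Set D}
    (hA : A.Finite) (hσ : ∀ M ∈ A, f (σ M) = M) {J : D} (a : L) (ha : f a = J) :
    ∃ b, f b = J ∧ (∀ M ∈ A, J ≤ M → b ≤ σ M) ∧
      ∀ x ≤ a, (∀ M ∈ A, J ≤ M → x ≤ σ M) → x ≤ b := by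
  induction A, hA using Set.Finite.induction_on with
  | empty => exact ⟨a, ha, fun _ h => h.elim, fun x hx _ => hx⟩
  | @insert K A _ _ ih =>
    obtain ⟨b, hb, h, h'⟩ := ih fun M hM => hσ M (Or.inr hM)
    by_cases hK : J ≤ K
    · refine ⟨b ⊓ σ K, ?_, ?_, fun x hx hxA => le_inf (h' x hx fun M hM => hxA M (Or.inr hM))
        (hxA K (Or.inl rfl) hK)⟩
      · rw [hinf, hb, hσ K (Or.inl rfl), inf_eq_left.mpr hK]
      · rintro M (rfl | hM) hMJ
        exacts [inf_le_right, inf_le_left.trans (h M hM hMJ)]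
    · refine ⟨b, hb, ?_, fun x hx hxA => h' x hx fun M hM => hxA M (Or.inr hM)⟩
      rintro M (rfl | hM) hMJ
      exacts [(hK hMJ).elim, h M hM hMJ]

/-- A surjective lattice homomorphism onto `D` has an isotone section if `D` has a well-ordering
for which the comparabilities between an element and the earlier elements all factor through
finitely many of the latter. -/
theorem exists_monotone_section (hsup : ∀ a b, f (a ⊔ b) = f a ⊔ f b)
    (hinf : ∀ a b, f (a ⊓ b) = f a ⊓ f b) (hsurj : Function.Surjective f)
    (r : D → D → Prop) [IsWellOrder D r]
    (h : ∀ J, ∃ A : Set D, A.Finite ∧ (∀ M ∈ A, r M J) ∧ ∀ K, r K J →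
      (K ≤ J → ∃ M ∈ A, K ≤ M ∧ M ≤ J) ∧ (J ≤ K → ∃ M ∈ A, J ≤ M ∧ M ≤ K)) :
    ∃ σ : D → L, Monotone σ ∧ ∀ J, f (σ J) = J := by
  classical
  choose A hA hAr hAK using h
  have hwf : WellFounded r := IsWellFounded.wf
  -- Only the finitely many constraints coming from `A J` are imposed at stage `J`.
  let good : (J : D) → ((K : D) → r K J → L) → L → Prop := fun J τ a =>
    f a = J ∧ ∀ M (hM : M ∈ A J), (M ≤ J → τ M (hAr J M hM) ≤ a) ∧
      (J ≤ M → a ≤ τ M (hAr J M hM))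
  -- The fallback preimage is never used: `hall` shows that a good value exists at every stage.
  let σ : D → L := hwf.fix fun J τ => if h : ∃ a, good J τ a then h.choose else (hsurj J).choose
  have hσ : ∀ J, (∃ a, good J (fun K _ => σ K) a) → good J (fun K _ => σ K) (σ J) := by
    intro J hJ
    have e : σ J = hJ.choose := by
      simp only [σ]
      rw [hwf.fix_eq]
      exact dif_pos hJ
    rw [e]
    exact hJ.choose_spec
  -- Interpolation through `A K` extends the finitely many constraints to all earlier elements,
  -- given that `σ` is already isotone on those.
  have hcompat : ∀ K, (∀ M, r M K ∨ M = K → good M (fun K _ => σ K) (σ M)) →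
      ∀ M, r M K → (M ≤ K → σ M ≤ σ K) ∧ (K ≤ M → σ K ≤ σ M) := by
    intro K
    induction K using hwf.induction with
    | _ K ih =>
    intro hgood M hMK
    have hlow : ∀ P Q, r P K → r Q K → P ≤ Q → σ P ≤ σ Q := by
      have hih : ∀ Q, r Q K → ∀ P, r P Q → (P ≤ Q → σ P ≤ σ Q) ∧ (Q ≤ P → σ Q ≤ σ P) :=
        fun Q hQ => ih Q hQ fun P hP => hgood P (Or.inl
          (hP.elim (fun h => _root_.trans h hQ) fun h => h ▸ hQ))
      intro P Q hP hQ hPQ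
      rcases trichotomous_of r P Q with h | rfl | h
      · exact (hih Q hQ P h).1 hPQ
      · exact le_rfl
      · exact (hih P hP Q h).2 hPQ
    have hK := (hgood K (Or.inr rfl)).2
    constructor
    · intro h
      obtain ⟨P, hPA, h1, h2⟩ := (hAK K M hMK).1 h
      exact (hlow M P hMK (hAr K P hPA) h1).trans ((hK P hPA).1 h2)
    · intro h
      obtain ⟨P, hPA, h1, h2⟩ := (hAK K M hMK).2 h
      exact ((hK P hPA).2 h1).trans (hlow P M (hAr K P hPA) hMK h2)
  have hall : ∀ J, good J (fun K _ => σ K) (σ J) := by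
    intro J
    induction J using hwf.induction with
    | _ J ih =>
    have hsec : ∀ M ∈ A J, f (σ M) = M := fun M hM => (ih M (hAr J M hM)).1
    have hmono : ∀ P Q, r P J → r Q J → P ≤ Q → σ P ≤ σ Q := by
      have hih : ∀ Q, r Q J → ∀ P, r P Q → (P ≤ Q → σ P ≤ σ Q) ∧ (Q ≤ P → σ Q ≤ σ P) :=
        fun Q hQ => hcompat Q fun P hP => ih P
          (hP.elim (fun h => _root_.trans h hQ) fun h => h ▸ hQ)
      intro P Q hP hQ hPQ
      rcases trichotomous_of r P Q with h | rfl | h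
      · exact (hih Q hQ P h).1 hPQ
      · exact le_rfl
      · exact (hih P hP Q h).2 hPQ
    obtain ⟨a, ha⟩ := hsurj J
    obtain ⟨b, hb, h1⟩ := exists_preimage_ge hsup (hA J) hsec a ha
    obtain ⟨c, hc, h2, h3⟩ := exists_preimage_le hinf (hA J) hsec b hb
    -- For `M ≤ J ≤ P` in `A J`, isotonicity on earlier elements gives `σ M ≤ σ P`, so lowering `b`
    -- to `c` keeps it above `σ M`.
    exact hσ J ⟨c, hc, fun M hM => ⟨fun hMJ => h3 _ (h1 M hM hMJ) fun P hP hJP =>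
      hmono M P (hAr J M hM) (hAr J P hP) (hMJ.trans hJP), h2 M hM⟩⟩
  refine ⟨σ, fun P Q hPQ => ?_, fun J => (hall J).1⟩
  rcases trichotomous_of r P Q with h | rfl | h
  · exact (hcompat Q (fun M _ => hall M) P h).1 hPQ
  · exact le_rfl
  · exact (hcompat P (fun M _ => hall M) Q h).2 hPQ

end MonotoneSection

/-! ### From an isotone section to a deviation -/

section Belluce

variable {G : Type*} [AddCommGroup G] [Lattice G] [IsOrderedAddMonoid G]

theorem belluceMap_surjective : Function.Surjective (belluceMap (G := G)) := by
  rintro ⟨_, a, rfl⟩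
  refine ⟨⟨|a|, abs_nonneg a⟩, Subtype.ext ?_⟩
  change lIdealSpan |a| = lIdealSpan a
  ext x
  rw [mem_lIdealSpan, mem_lIdealSpan, abs_abs]

/-- An isotone section `σ` of the Belluce map yields the monotone Cevian deviation that sends
`J` and `K` to the ℓ-ideal generated by `(σ J - σ K)⁺`. -/
theorem isMonotoneCevian_of_section (σ : PrincipalLIdeal G → {a : G // 0 ≤ a}) (hσ : Monotone σ)
    (h : ∀ J, belluceMap (σ J) = J) : IsMonotoneCevian (PrincipalLIdeal G) := by
  have hle : ∀ a b : {a : G // 0 ≤ a}, a.1 ≤ b.1 → belluceMap a ≤ belluceMap b := by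
    intro a b hab
    refine (lIdealSpan_le (isLIdeal_lIdealSpan _)).mpr (mem_lIdealSpan.mpr ⟨1, ?_⟩)
    rwa [abs_of_nonneg a.2, abs_of_nonneg b.2, one_nsmul]
  have hadd : ∀ a b c : {a : G // 0 ≤ a}, c.1 ≤ a.1 + b.1 →
      belluceMap c ≤ belluceMap a ⊔ belluceMap b := by
    intro a b c hc
    refine (lIdealSpan_le ?_).mpr ?_
    · change IsLIdeal (lIdealSpan a.1 ⊔ lIdealSpan b.1)
      rw [lIdealSpan_sup]
      exact isLIdeal_lIdealSpan _
    · change c.1 ∈ lIdealSpan a.1 ⊔ lIdealSpan b.1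
      rw [lIdealSpan_sup]
      refine mem_lIdealSpan.mpr ⟨2, ?_⟩
      rw [abs_of_nonneg a.2, abs_of_nonneg b.2, abs_of_nonneg c.2,
        abs_of_nonneg (a.2.trans le_sup_left), two_nsmul]
      exact hc.trans (add_le_add le_sup_left le_sup_right)
  refine ⟨fun J K => belluceMap ⟨((σ J).1 - (σ K).1)⁺, posPart_nonneg _⟩,
    ⟨⟨fun J K => ?_, fun J K => ?_⟩, fun J J' K hJ => ?_, fun J K K' hK => ?_, fun J K M => ?_⟩⟩
  · have hJK := hadd (σ K) ⟨((σ J).1 - (σ K).1)⁺, posPart_nonneg _⟩ (σ J)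
      (sub_le_iff_le_add'.mp (le_posPart _))
    rwa [h, h] at hJK
  -- The two generators are the positive and negative parts of one element, hence disjoint.
  · refine le_bot_iff.mp ?_
    intro x hx
    change x ∈ lIdealSpan _ ⊓ lIdealSpan _ at hx
    rw [lIdealSpan_inf, abs_of_nonneg (posPart_nonneg _), abs_of_nonneg (posPart_nonneg _),
      ← neg_sub (σ J).1, posPart_neg, posPart_inf_negPart_eq_zero, mem_lIdealSpan] at hx
    obtain ⟨n, hn⟩ := hx
    rw [abs_zero, nsmul_zero] at hn
    have hx := abs_le'.mp hn
    exact AddSubgroup.mem_bot.mpr (le_antisymm hx.1 (neg_nonpos.mp hx.2))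
  · exact hle _ _ (posPart_mono (sub_le_sub_right (show (σ _).1 ≤ (σ _).1 from hσ hJ) _))
  · exact hle _ _ (posPart_mono (sub_le_sub_left (show (σ _).1 ≤ (σ _).1 from hσ hK) _))
  -- The Cevian inequality comes from subadditivity of the positive part.
  · refine hadd _ _ _ ?_
    refine sup_le ?_ (add_nonneg (posPart_nonneg _) (posPart_nonneg _))
    rw [← sub_add_sub_cancel (σ J).1 (σ K).1 (σ M).1]
    exact add_le_add (le_posPart _) (le_posPart _)

end Belluce

/-! ### The well-ordering by supports, and the conclusion -/

namespace PrincipalLIdeal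

/-- The lattice of principal ℓ-ideals of a free Abelian ℓ-group has a well-ordering for which the
comparabilities between an element and the earlier elements all factor through finitely many of
the latter. -/
theorem exists_wellOrder_interpolation (I : Type*) :
    ∃ r : PrincipalLIdeal (FreeAbelianLGroup I) → PrincipalLIdeal (FreeAbelianLGroup I) → Prop,
      IsWellOrder _ r ∧ ∀ J, ∃ A : Set (PrincipalLIdeal (FreeAbelianLGroup I)), A.Finite ∧
        (∀ M ∈ A, r M J) ∧ ∀ K, r K J →
          (K ≤ J → ∃ M ∈ A, K ≤ M ∧ M ≤ J) ∧ (J ≤ K → ∃ M ∈ A, J ≤ M ∧ M ≤ K) := by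
  classical
  have hmin : ∀ J : PrincipalLIdeal (FreeAbelianLGroup I), ∃ S : Finset I,
      J.IsSupported (S : Set I) ∧ ∀ T : Finset I, J.IsSupported (T : Set I) → S.card ≤ T.card := by
    intro J
    obtain ⟨S, hS, h⟩ := exists_minimalFor_of_wellFoundedLT
      (fun S : Finset I => J.IsSupported (S : Set I)) Finset.card J.exists_isSupported
    exact ⟨S, hS, fun T hT => (le_total _ _).elim id fun h' => h hT h'⟩
  choose s hs hsmin using hmin
  have hcount : ∀ S : Finset I, ∃ e : PrincipalLIdeal (FreeAbelianLGroup I) → ℕ,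
      Set.InjOn e {J | J.IsSupported (S : Set I)} := fun S =>
    Set.countable_iff_exists_injOn.mp (countable_isSupported S.countable_toSet)
  choose e he using hcount
  -- Cardinality comes first so that losing a variable moves an ideal earlier; the enumeration comes
  -- last so that only finitely many ideals with the same chosen support precede a given one.
  let key : PrincipalLIdeal (FreeAbelianLGroup I) → ℕ × Finset I × ℕ :=
    fun J => ((s J).card, s J, e (s J) J)
  have hkey : Function.Injective key := by
    intro J K h
    simp only [key, Prod.mk.injEq] at h
    obtain ⟨-, h1, h2⟩ := h
    refine he (s J) (hs J) ?_ ?_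
    · rw [h1]
      exact hs K
    · rw [h2, h1]
  let R : ℕ × Finset I × ℕ → ℕ × Finset I × ℕ → Prop :=
    Prod.Lex (· < ·) (Prod.Lex WellOrderingRel (· < ·))
  have hR : IsWellOrder _ R := inferInstance
  let φ : (key ⁻¹'o R) ↪r R := ⟨⟨key, hkey⟩, Iff.rfl⟩
  refine ⟨key ⁻¹'o R, φ.isWellOrder, fun J => ?_⟩
  have hfl := fun E : Finset I => exists_floor_of_finite E.finite_toSet (hs J)
  have hce := fun E : Finset I => exists_ceil_of_finite E.finite_toSet (hs J)
  choose fl hflS hflJ hfl using hfl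
  choose ce hceS hce using hce
  -- The intersection discards floors and ceilings that are not earlier than `J`, such as those that
  -- eliminate nothing.
  refine ⟨{M | R (key M) (key J)} ∩ (fl '' (s J).powerset ∪ ce '' (s J).powerset ∪
    {M | s M = s J ∧ e (s J) M < e (s J) J}), ?_, fun M hM => hM.1, fun K hK => ?_⟩
  · refine Set.Finite.inter_of_right (Set.Finite.union (Set.Finite.union ?_ ?_) ?_) _
    · exact (Finset.finite_toSet _).image _
    · exact (Finset.finite_toSet _).image _
    · refine Set.Finite.of_finite_image
        ((Set.finite_Iio (e (s J) J)).subset ?_) ((he (s J)).mono ?_)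
      · rintro _ ⟨M, hM, rfl⟩
        exact hM.2
      · rintro M ⟨hM, -⟩
        change IsSupported _ M
        rw [← hM]
        exact hs M
  by_cases hKJ : s K = s J
  · have hlt : e (s J) K < e (s J) J := by
      have h : R (key K) (key J) := hK
      simpa [R, key, hKJ, Prod.lex_def, irrefl] using h
    exact ⟨fun h => ⟨K, ⟨hK, Or.inr ⟨hKJ, hlt⟩⟩, le_rfl, h⟩,
      fun h => ⟨K, ⟨hK, Or.inr ⟨hKJ, hlt⟩⟩, h, le_rfl⟩⟩
  · have hcard : (s K).card ≤ (s J).card := by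
      have h : R (key K) (key J) := hK
      simp only [R, key, Prod.lex_def] at h
      omega
    -- A different support that is no larger must miss some variable of `J`; these missing variables
    -- are the ones to eliminate.
    have hE : (s J \ s K).Nonempty := by
      rw [Finset.sdiff_nonempty]
      exact fun h => hKJ (Finset.eq_of_subset_of_card_le h hcard).symm
    have hearlier : ∀ M : PrincipalLIdeal (FreeAbelianLGroup I),
        M.IsSupported ((s J : Set I) \ (s J \ s K : Finset I)) → R (key M) (key J) := by
      intro M hM
      rw [← Finset.coe_sdiff] at hM
      exact Prod.Lex.left _ _ ((hsmin M _ hM).trans_lt (Finset.card_lt_card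
        (Finset.sdiff_ssubset Finset.sdiff_subset hE)))
    have hdisj : Disjoint ((s J \ s K : Finset I) : Set I) (s K : Set I) :=
      Finset.disjoint_coe.mpr Finset.sdiff_disjoint
    have hpow : s J \ s K ∈ ((s J).powerset : Set (Finset I)) :=
      Finset.mem_coe.mpr (Finset.mem_powerset.mpr Finset.sdiff_subset)
    constructor
    · intro h
      exact ⟨fl (s J \ s K), ⟨hearlier _ (hflS _), Or.inl (Or.inl ⟨_, hpow, rfl⟩)⟩,
        hfl _ K _ (hs K) hdisj h, hflJ _⟩
    · intro h
      exact ⟨ce (s J \ s K), ⟨hearlier _ (hceS _), Or.inl (Or.inr ⟨_, hpow, rfl⟩)⟩,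
        hce _ K _ (hs K) hdisj h⟩

end PrincipalLIdeal

theorem corollaryC (I : Type*) :
    IsMonotoneCevian (PrincipalLIdeal (FreeAbelianLGroup I)) ∧
      ∃ σ : PrincipalLIdeal (FreeAbelianLGroup I) → {a : FreeAbelianLGroup I // 0 ≤ a},
        Monotone σ ∧ ∀ J, belluceMap (σ J) = J := by
  let _ : Lattice {a : FreeAbelianLGroup I // 0 ≤ a} :=
    Subtype.lattice (fun _ _ ha _ => le_trans ha le_sup_left) fun _ _ ha hb => le_inf ha hb
  obtain ⟨r, hr, h⟩ := PrincipalLIdeal.exists_wellOrder_interpolation I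
  obtain ⟨σ, hσ, hs⟩ := exists_monotone_section (f := belluceMap (G := FreeAbelianLGroup I))
    (fun a b => Subtype.ext (by
      change lIdealSpan (a.1 ⊔ b.1) = lIdealSpan a.1 ⊔ lIdealSpan b.1
      rw [lIdealSpan_sup, abs_of_nonneg a.2, abs_of_nonneg b.2]))
    (fun a b => Subtype.ext (by
      change lIdealSpan (a.1 ⊓ b.1) = lIdealSpan a.1 ⊓ lIdealSpan b.1
      rw [lIdealSpan_inf, abs_of_nonneg a.2, abs_of_nonneg b.2]))
    belluceMap_surjective r h
  exact ⟨isMonotoneCevian_of_section σ hσ hs, σ, hσ, hs⟩
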